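/- **Setting.** Let $\mathcal M=\{S,A,r,P,\rho_0,\gamma\}$ be a discrete Markov decision process (initial, transition and action distributions are probability mass functions), with $|r(s,a)|\le R_{\max}$ and $\gamma\in(0,1)$. For a (stationary, randomized) policy $\pi$ let $V^\pi(s,\mathcal M)=\mathbb E[\sum_{t\ge0}\gamma^t r(s_t,a_t)\mid s_0=s]$, $J_{\rho_0}(\pi,\mathcal M)=\mathbb E_{s\sim\rho_0}V^\pi(s,\mathcal M)$ and $d^{\pi,\mathcal M}(s,a)=(1-\gamma)\sum_{t\ge 0}\gamma^t\,\mathbb P(s_t=s,a_t=a)$ with $s_0\sim\rho_0$; for $U\subseteq S\times A$ let $d^{\pi,\mathcal M}(U)=\sum_{(s,a)\in U}d^{\pi,\mathcal M}(s,a)$ and let $T^\pi_U\in\mathbb N\cup\{\infty\}$ be the first time $t$ with $(s_t,a_t)\in U$ ($\gamma^\infty=0$). Let $\pi_b$ be the behavior policy. Assume that $\rho_0$, the transition probabilities $P(\cdot|s,a)$ (over all $(s,a)$), and $d^{\pi_b,\mathcal M}$ have smallest non-zero values, denoted $\rho_{0,\min},\,p_{\min},\,d_{\min}>0$. Let $\delta\in(0,1)$.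 **Data.** The dataset $\mathcal D$ comes from $n$ independent trajectories of $\pi_b$ started from $\rho_0$; of the $i$-th one the initial state and the first $\ell_i$ transitions $(s_t,a_t,s_{t+1})$, $t<\ell_i$, are recorded. The lengths $\ell_i$ are finite, i.i.d. and independent of the trajectories, with $\mathbb P(\ell_i>t)\ge\gamma^t$ for every $t$ such that $\gamma^t>d_{\min}/4$ (for instance geometric lengths with continuation probability $\gamma$, or any fixed horizon $H$ with $\gamma^H\le d_{\min}/4$). Let $n_{(s,a)}$ be the number of recorded transitions from $(s,a)$. **Algorithm (MOReL).** Let $\hat\rho_0$ and $\hat P(\cdot|s,a)$ be the empirical distributions of the recorded initial states and of the recorded successors of $(s,a)$ (arbitrary where there are no data). For a constant $C$, put $$\alpha=\frac{C}{p_{\min}}\sqrt{\frac{\log\frac1{\delta p_{\min}d_{\min}}}{d_{\min}n}},\qquad \mathcal U_0=\{(s,a): n_{(s,a)}<d_{\min}n/2\}.$$ A set $\mathcal U\subseteq S\times A$ of pairs flagged as unknown is a correct $\alpha$-USAD if $D_{TV}(\hat P(\cdot|s,a),P(\cdot|s,a))\le\alpha$ for all $(s,a)\notin\mathcal U$. The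 pessimistic MDP $\hat{\mathcal M}_p$ has states $S\cup\{\mathrm{HALT}\}$, actions $A$, initial distribution $\hat\rho_0$, discount $\gamma$; a pair in $\mathcal U$, and any action at HALT, leads to HALT, other pairs move according to $\hat P$; the reward is $-R_{\max}$ at HALT and $r(s,a)$ otherwise. The planner returns a policy that is $\epsilon_\pi$-suboptimal in $\hat{\mathcal M}_p$, and $\pi_{\rm out}$ is this policy restricted to $S$. **Claim.** There is a universal constant $C_0>0$ such that the following holds for every $C\ge C_0$ and all data as above. Put $$\epsilon_n=\frac{4CR_{\max}}{(1-\gamma)\rho_{0,\min}}\sqrt{\frac{\log\frac1{\delta\rho_{0,\min}}}{n}}+\frac{4C\gamma R_{\max}}{(1-\gamma)^2p_{\min}}\sqrt{\frac{\log\frac1{\delta p_{\min}d_{\min}}}{d_{\min}n}} .$$ Then $\epsilon_n\to0$ as $n\to\infty$, and if $n\ge\frac{C}{d_{\min}^2}\log\frac1{\delta d_{\min}}$, then with probability at least $1-C\delta$ over the dataset: $\mathcal U_0$ is a correct $\alpha$-USAD; and for $\mathcal U=\mathcal U_0$, and more generally for every correct $\alpha$-USAD $\mathcal U\subseteq\mathcal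 U_0$, every $\epsilon_\pi$ and every possible output $\pi_{\rm out}$, $$J_{\rho_0}(\pi_b,\mathcal M)-J_{\rho_0}(\pi_{\rm out},\mathcal M)\le\epsilon_\pi+\epsilon_n,$$ and for every policy $\pi^*$ that maximizes $J_{\rho_0}(\cdot,\mathcal M)$, $$J_{\rho_0}(\pi^*,\mathcal M)-J_{\rho_0}(\pi_{\rm out},\mathcal M)\le\epsilon_\pi+\frac{2R_{\max}}{1-\gamma}\,\mathbb E\big[\gamma^{T^{\pi^*}_{\mathcal U}}\big]+\epsilon_n\le\epsilon_\pi+\frac{2R_{\max}}{(1-\gamma)^2}\,d^{\pi^*,\mathcal M}(\mathcal U)+\epsilon_n .$$ -/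

import Mathlib

open MeasureTheory ProbabilityTheory

noncomputable section

namespace MOReL

universe u v

/-- A state-action pair `(s, a)`. The type carries the discrete sigma-algebra. -/
@[ext] structure StateAction (S : Type u) (A : Type v) where
  state : S
  action : A

instance (S : Type u) (A : Type v) : MeasurableSpace (StateAction S A) := ⊤

instance (S : Type u) (A : Type v) : DiscreteMeasurableSpace (StateAction S A) :=
  ⟨fun _ => trivial⟩

/-- A (discrete) Markov decision process `{S, A, r, P, ρ₀, γ}`. -/
structure MDP (S : Type u) (A : Type v) where
  /-- reward function -/
  r : S → A → ℝ
  /-- transition kernel, `P s a s'` is the probability of moving to `s'` -/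
  P : S → A → PMF S
  /-- initial state distribution -/
  ρ₀ : PMF S
  /-- discount factor -/
  γ : ℝ

/-- A policy maps states to probability distributions over actions. -/
abbrev Policy (S : Type u) (A : Type v) := S → PMF A

variable {S : Type u} {A : Type v}

/-- Draw the state from `ρ`, then the action from the policy. -/
def drawPair (ρ : PMF S) (π : Policy S A) : PMF (StateAction S A) :=
  ρ.bind fun s => (π s).map fun a => ⟨s, a⟩

namespace MDP

/-- One step of the chain of state-action pairs that the policy `π` induces on `M`. -/
def stepKernel (M : MDP S A) (π : Policy S A) (n : ℕ) :
    Kernel (Π _ : Finset.Iic n, StateAction S A) (StateAction S A) where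
  toFun h :=
    (drawPair (M.P (h ⟨n, Finset.mem_Iic.2 le_rfl⟩).state
      (h ⟨n, Finset.mem_Iic.2 le_rfl⟩).action) π).toMeasure
  measurable' :=
    (measurable_from_top (f := fun x : StateAction S A =>
      (drawPair (M.P x.state x.action) π).toMeasure)).comp (measurable_pi_apply _)

instance (M : MDP S A) (π : Policy S A) (n : ℕ) : IsMarkovKernel (M.stepKernel π n) :=
  ⟨fun _ => PMF.toMeasure.isProbabilityMeasure _⟩

/-- The law of the infinite trajectory `(s_0, a_0), (s_1, a_1), …` generated by the policy `π` on
`M` when `s_0 ∼ ρ`. -/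
def pathFrom (M : MDP S A) (ρ : PMF S) (π : Policy S A) : Measure (ℕ → StateAction S A) :=
  Kernel.trajMeasure (X := fun _ => StateAction S A) (drawPair ρ π).toMeasure (M.stepKernel π)

instance (M : MDP S A) (ρ : PMF S) (π : Policy S A) : IsProbabilityMeasure (M.pathFrom ρ π) := by
  have : IsProbabilityMeasure (drawPair ρ π).toMeasure := PMF.toMeasure.isProbabilityMeasure _
  unfold pathFrom
  infer_instance

/-- The law of the trajectory of `π` on `M` with `s_0 ∼ ρ₀`. -/
def path (M : MDP S A) (π : Policy S A) : Measure (ℕ → StateAction S A) :=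
  M.pathFrom M.ρ₀ π

/-- The value `V^π(s, M) = 𝔼[∑ₜ γᵗ r(sₜ, aₜ) | s₀ = s]`. -/
def V (M : MDP S A) (π : Policy S A) (s : S) : ℝ :=
  ∫ ω, ∑' t : ℕ, M.γ ^ t * M.r (ω t).state (ω t).action ∂(M.pathFrom (PMF.pure s) π)

/-- The performance `J_{ρ₀}(π, M) = 𝔼_{s ∼ ρ₀}[V^π(s, M)]`. -/
def J (M : MDP S A) (π : Policy S A) : ℝ :=
  ∑' s : S, (M.ρ₀ s).toReal * M.V π s

/-- `π` is `ε`-suboptimal for `M`: no policy beats it by more than `ε`. -/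
def IsSuboptimal (M : MDP S A) (ε : ℝ) (π : Policy S A) : Prop :=
  ∀ π' : Policy S A, M.J π' - M.J π ≤ ε

/-- `π` is an optimal policy of `M`. -/
def IsOptimal (M : MDP S A) (π : Policy S A) : Prop :=
  ∀ π' : Policy S A, M.J π' ≤ M.J π

/-- Discounted visitation distribution
`d^{π,M}(s,a) = (1-γ) ∑ₜ γᵗ ℙ(sₜ = s, aₜ = a | s₀ ∼ ρ₀, π, M)`. -/
def visitation (M : MDP S A) (π : Policy S A) (x : StateAction S A) : ℝ :=
  (1 - M.γ) * ∑' t : ℕ, M.γ ^ t * (M.path π).real {ω | ω t = x}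

/-- `d^{π,M}(U) = ∑_{(s,a) ∈ U} d^{π,M}(s,a)`. -/
def visitationSet (M : MDP S A) (π : Policy S A) (U : Set (StateAction S A)) : ℝ :=
  ∑' x : U, M.visitation π x

end MDP

/-- First time at which the trajectory `ω` is at `x`, equal to `∞` if this never happens. -/
def hittingTime (x : StateAction S A) (ω : ℕ → StateAction S A) : ℕ∞ :=
  ⨅ (t : ℕ) (_ : ω t = x), (t : ℕ∞)

/-- Hitting time of a set of state-action pairs. -/
def hittingTimeSet (U : Set (StateAction S A)) (ω : ℕ → StateAction S A) : ℕ∞ :=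
  ⨅ x ∈ U, hittingTime x ω

/-- `γ ^ T` for `T ∈ ℕ ∪ {∞}`, with `γ ^ ∞ = 0`. -/
def discountPow (γ : ℝ) : ℕ∞ → ℝ
  | ⊤ => 0
  | (t : ℕ) => γ ^ t

/-- `𝔼[γ ^ {T_U^π}]`, for `π` run on `M` from `ρ₀`. -/
def MDP.expDiscountHitting (M : MDP S A) (π : Policy S A) (U : Set (StateAction S A)) : ℝ :=
  ∫ ω, discountPow M.γ (hittingTimeSet U ω) ∂(M.path π)

/-- Total variation distance of two discrete distributions. -/
def tvDist {α : Type*} (p q : PMF α) : ℝ :=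
  (1 / 2) * ∑' x, |(p x).toReal - (q x).toReal|

/-- The raw outcome of collecting `n` trajectories: for each of them an infinite trajectory of
state-action pairs, and the number of its transitions that are recorded. -/
abbrev Sample (S : Type u) (A : Type v) (n : ℕ) := Fin n → (ℕ → StateAction S A) × ℕ

/-- `n` independent trajectories of `π` on `M`; the numbers of recorded transitions are drawn from
`len`, independently of each other and of the trajectories. -/
def sampleLaw (M : MDP S A) (π : Policy S A) (len : PMF ℕ) (n : ℕ) : Measure (Sample S A n) :=
  Measure.pi fun _ : Fin n => (M.path π).prod len.toMeasure

/-- An offline dataset: the initial states of the trajectories and all recorded transitions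
`((s, a), s')`. (The reward function is known, so that rewards carry no further information.) -/
structure Dataset (S : Type u) (A : Type v) where
  init : Multiset S
  trans : Multiset (StateAction S A × S)

/-- The dataset consisting of the initial states and of the first `(ω i).2` transitions
`((s_t, a_t), s_{t+1})` of every trajectory `i`. -/
def Sample.dataset {n : ℕ} (ω : Sample S A n) : Dataset S A where
  init := (Finset.univ : Finset (Fin n)).val.map fun i => ((ω i).1 0).state
  trans := ∑ i : Fin n,
    (Multiset.range (ω i).2).map fun t => ((ω i).1 t, ((ω i).1 (t + 1)).state)

/-- Empirical distribution of a multiset of observations; `fallback` if there are none. -/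
def empirical {α : Type*} (l : Multiset α) (fallback : PMF α) : PMF α :=
  open Classical in if h : l = 0 then fallback else PMF.ofMultiset l h

namespace Dataset

/-- The successor states recorded after `x` in the dataset, with multiplicity. -/
def successors (D : Dataset S A) (x : StateAction S A) : Multiset S :=
  open Classical in (D.trans.filter fun y => y.1 = x).map Prod.snd

/-- `n_{(s,a)}`: the number of times that `x = (s,a)` appears in the dataset. -/
def count (D : Dataset S A) (x : StateAction S A) : ℕ := Multiset.card (D.successors x)

/-- The learned (maximum likelihood) initial distribution `ρ̂₀`. -/
def rhoHat (D : Dataset S A) (fallback : PMF S) : PMF S := empirical D.init fallback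

/-- The learned (maximum likelihood) transition model `P̂`; at pairs without data it is whatever
`fallback` prescribes. -/
def PHat (D : Dataset S A) (fallback : S → A → PMF S) (s : S) (a : A) : PMF S :=
  empirical (D.successors ⟨s, a⟩) (fallback s a)

/-- The pairs that a count-based detector flags as unknown: those with fewer than `m`
occurrences in the dataset. -/
def lowCount (D : Dataset S A) (m : ℝ) : Set (StateAction S A) := {x | (D.count x : ℝ) < m}

end Dataset

/-- The set `U` of unknown pairs is that of a correct `α`-unknown state-action detector for the
model `Phat` of `P`: on every pair flagged as known the model is `α`-accurate. -/
def IsUSAD (α : ℝ) (P Phat : S → A → PMF S) (U : Set (StateAction S A)) : Prop :=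
  ∀ s a, (⟨s, a⟩ : StateAction S A) ∉ U → tvDist (Phat s a) (P s a) ≤ α

/-- The pessimistic MDP with HALT penalty `κ`, on the state space `S ∪ {HALT}` (`none` is HALT):
unknown pairs lead to the absorbing state HALT, where the reward is `-κ`. -/
def pessimisticMDP (r : S → A → ℝ) (γ κ : ℝ) (rhoHat : PMF S) (Phat : S → A → PMF S)
    (U : Set (StateAction S A)) : MDP (Option S) A where
  r
    | none, _ => -κ
    | some s, a => r s a
  P
    | none, _ => PMF.pure none
    | some s, a => open Classical in
        if (⟨s, a⟩ : StateAction S A) ∈ U then PMF.pure none else (Phat s a).map some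
  ρ₀ := rhoHat.map some
  γ := γ

/-- The policies that the algorithm may return: the planner produces an `ε`-suboptimal policy of
the pessimistic MDP, and the output is this policy on the original states. -/
def IsOutput (M : MDP S A) (κ ε : ℝ) (rhoHat : PMF S) (Phat : S → A → PMF S)
    (U : Set (StateAction S A)) (πout : Policy S A) : Prop :=
  ∃ πp : Policy (Option S) A,
    (pessimisticMDP M.r M.γ κ rhoHat Phat U).IsSuboptimal ε πp ∧ πout = fun s => πp (some s)

/-- The accuracy level `α` guaranteed by the data. -/
def alphaN (C δ pmin dmin : ℝ) (n : ℕ) : ℝ :=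
  C / pmin * √(Real.log (1 / (δ * pmin * dmin)) / (dmin * n))

/-- The sampling error term `ε_n`. -/
def epsN (C Rmax γ δ ρmin pmin dmin : ℝ) (n : ℕ) : ℝ :=
  4 * C * Rmax / ((1 - γ) * ρmin) * √(Real.log (1 / (δ * ρmin)) / n) +
    4 * C * γ * Rmax / ((1 - γ) ^ 2 * pmin) *
      √(Real.log (1 / (δ * pmin * dmin)) / (dmin * n))

end MOReL

end

noncomputable section

namespace MOReL

universe u v

variable {S : Type u} {A : Type v}

/-! The argument splits into a deterministic comparison of two MDPs and a concentration estimate for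
the data.

Deterministic part. Put B = R/(1-γ), a bound for all values in both MDPs. Fix a policy and compare
its Bellman equations in the true and in the pessimistic MDP. At a pair outside `U`, replacing
`Phat` by `P` costs at most γ·2αB, and what remains is γ times the true conditional mean of the
difference itself. At a pair of `U`, the pessimistic process continues with -B, the least possible
value. Iterating these bounds (`le_of_discounted_bound`) shows that pessimism never overestimates by
more than the model error (`pessimisticMDP_J_le`). It underestimates by at most the same error plus
2B times `hitValue`, which is 1 on `U` and satisfies the reward-free Bellman equation off `U`
(`J_sub_pessimisticMDP_J_le`). Passing to the pessimistic MDP with the comparison policy, using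
near-optimality there, and passing back with the output gives `J_sub_J_output_le`. The killed series
of the first visit identifies the mean of `hitValue` with E[γ^T], and counting all visits instead of
the first bounds it by d(U)/(1-γ).

Probabilistic part. The recorded piece of a trajectory visits x with probability at least d(x) -
dmin/4 (`visitation_sub_le`), so Hoeffding's inequality over independent trajectories gives at least
dmin·n/2 visits to every x charged by the behavior policy. The moves out of x are dependent and
random in number. They are controlled by an exponential supermartingale that increases only at
visits to x (`lintegral_prod_increment`), whose exponent grows with the actual number of visits.
Nonzero probabilities are bounded below, so all supports are finite with explicit size and union
bounds suffice; for total variation, lower bounds on the frequencies are enough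
(`tvDist_le_card_mul`).

On the resulting event (`exists_good_event`) every pair with few visits has zero behavior
visitation. Hence the hitting term vanishes for the behavior policy (`guarantees_of_accurate`). -/

/-- Expectation of a real function under a probability mass function. -/
def mean {α : Type*} (p : PMF α) (f : α → ℝ) : ℝ := ∑' x, (p x).toReal * f x

/-- A real function with bounded range. -/
def IsBdd {α : Type*} (f : α → ℝ) : Prop := ∃ B, ∀ x, |f x| ≤ B

/-! ### Expectations under discrete laws, geometric series, total variation. -/

section Mean

variable {α β : Type*}

lemma IsBdd.add {f g : α → ℝ} (hf : IsBdd f) (hg : IsBdd g) : IsBdd fun x => f x + g x := by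
  obtain ⟨B, hB⟩ := hf
  obtain ⟨B', hB'⟩ := hg
  exact ⟨B + B', fun x => (abs_add_le _ _).trans (add_le_add (hB x) (hB' x))⟩

lemma IsBdd.const_mul {f : α → ℝ} (c : ℝ) (hf : IsBdd f) : IsBdd fun x => c * f x := by
  obtain ⟨B, hB⟩ := hf
  exact ⟨|c| * B, fun x => by
    rw [abs_mul]; exact mul_le_mul_of_nonneg_left (hB x) (abs_nonneg c)⟩

lemma IsBdd.sub {f g : α → ℝ} (hf : IsBdd f) (hg : IsBdd g) : IsBdd fun x => f x - g x := by
  simpa [sub_eq_add_neg] using hf.add (hg.const_mul (-1))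

lemma summable_toReal (p : PMF α) : Summable fun x => (p x).toReal :=
  ENNReal.summable_toReal (by rw [p.tsum_coe]; simp)

lemma tsum_toReal (p : PMF α) : ∑' x, (p x).toReal = 1 := by
  rw [← ENNReal.tsum_toReal_eq p.apply_ne_top, p.tsum_coe, ENNReal.toReal_one]

lemma IsBdd.summable {f : α → ℝ} (hf : IsBdd f) (p : PMF α) :
    Summable fun x => (p x).toReal * f x := by
  obtain ⟨B, hB⟩ := hf
  refine Summable.of_norm_bounded ((summable_toReal p).mul_right B) fun x => ?_
  rw [norm_mul, Real.norm_of_nonneg ENNReal.toReal_nonneg]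
  exact mul_le_mul_of_nonneg_left (hB x) ENNReal.toReal_nonneg

lemma mean_const_mul (p : PMF α) (c : ℝ) (f : α → ℝ) :
    mean p (fun x => c * f x) = c * mean p f := by
  simp only [mean, ← tsum_mul_left]
  exact tsum_congr fun x => by ring

lemma mean_sub (p : PMF α) {f g : α → ℝ} (hf : IsBdd f) (hg : IsBdd g) :
    mean p (fun x => f x - g x) = mean p f - mean p g := by
  simp only [mean, mul_sub]
  exact (hf.summable p).tsum_sub (hg.summable p)

lemma mean_const (p : PMF α) (c : ℝ) : mean p (fun _ => c) = c := by
  simp only [mean, tsum_mul_right, tsum_toReal, one_mul]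

lemma mean_mono (p : PMF α) {f g : α → ℝ} (hf : IsBdd f) (hg : IsBdd g) (h : ∀ x, f x ≤ g x) :
    mean p f ≤ mean p g :=
  (hf.summable p).tsum_le_tsum (fun x => mul_le_mul_of_nonneg_left (h x) ENNReal.toReal_nonneg)
    (hg.summable p)

lemma isBdd_const (c : ℝ) : IsBdd fun _ : α => c := ⟨|c|, fun _ => le_rfl⟩

lemma mean_le (p : PMF α) {f : α → ℝ} {B : ℝ} (hf : IsBdd f) (h : ∀ x, f x ≤ B) :
    mean p f ≤ B := by
  simpa [mean_const] using mean_mono p hf (isBdd_const B) h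

lemma abs_mean_le (p : PMF α) {f : α → ℝ} {B : ℝ} (h : ∀ x, |f x| ≤ B) : |mean p f| ≤ B := by
  have hf : IsBdd f := ⟨B, h⟩
  rw [abs_le]
  constructor
  · simpa [mean_const] using mean_mono p (isBdd_const (-B)) hf fun x => (abs_le.1 (h x)).1
  · exact mean_le p hf fun x => (abs_le.1 (h x)).2

lemma mean_eq_integral [MeasurableSpace α] [DiscreteMeasurableSpace α] (p : PMF α) {f : α → ℝ}
    (hf : IsBdd f) : mean p f = ∫ x, f x ∂p.toMeasure := by
  obtain ⟨B, hB⟩ := hf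
  have : IsProbabilityMeasure p.toMeasure := PMF.toMeasure.isProbabilityMeasure _
  rw [PMF.integral_eq_tsum]
  · rfl
  · exact Integrable.of_bound (Measurable.of_discrete (f := f)).aestronglyMeasurable B
      (Filter.Eventually.of_forall hB)

lemma mean_pure (x : α) (f : α → ℝ) : mean (PMF.pure x) f = f x := by
  rw [mean, tsum_eq_single x]
  · simp
  · intro y hy
    simp [PMF.pure_apply, hy]

lemma mean_bind (p : PMF α) (q : α → PMF β) {f : β → ℝ} (hf : IsBdd f) :
    mean (p.bind q) f = mean p fun x => mean (q x) f := by
  obtain ⟨B, hB⟩ := hf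
  have hf : IsBdd f := ⟨B, hB⟩
  have key : Summable (Function.uncurry fun (x : α) (y : β) =>
      (p x).toReal * ((q x y).toReal * f y)) := by
    refine Summable.of_norm ?_
    refine (summable_prod_of_nonneg fun _ => norm_nonneg _).2 ⟨fun x => ?_, ?_⟩
    · exact (((hf.summable (q x)).mul_left (p x).toReal).norm)
    · refine Summable.of_nonneg_of_le (fun x => tsum_nonneg fun _ => norm_nonneg _) (fun x => ?_)
        ((summable_toReal p).mul_right B)
      simp only [Function.uncurry_apply_pair, norm_mul, Real.norm_of_nonneg ENNReal.toReal_nonneg]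
      rw [tsum_mul_left]
      refine mul_le_mul_of_nonneg_left ?_ ENNReal.toReal_nonneg
      have hb : IsBdd fun y => ‖f y‖ := ⟨B, fun y => by simpa using hB y⟩
      exact mean_le (q x) hb hB
  have h1 := key.tsum_comm
  simp only [mean, ← tsum_mul_left]
  rw [← h1]
  refine tsum_congr fun y => ?_
  rw [PMF.bind_apply, ENNReal.tsum_toReal_eq (fun x => ENNReal.mul_ne_top (p.apply_ne_top x)
    ((q x).apply_ne_top y)), ← tsum_mul_right]
  exact tsum_congr fun x => by rw [ENNReal.toReal_mul]; ring

lemma mean_map (p : PMF α) (φ : α → β) {f : β → ℝ} (hf : IsBdd f) :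
    mean (p.map φ) f = mean p fun x => f (φ x) := by
  rw [← PMF.bind_pure_comp, mean_bind _ _ hf]
  simp [mean_pure]

lemma summable_geometric_mul {γ : ℝ} (h0 : 0 ≤ γ) (h1 : γ < 1) {u : ℕ → ℝ} {B : ℝ}
    (hu : ∀ t, |u t| ≤ B) : Summable fun t => γ ^ t * u t := by
  refine Summable.of_norm_bounded ((summable_geometric_of_lt_one h0 h1).mul_right B) fun t => ?_
  rw [norm_mul, norm_pow, Real.norm_of_nonneg h0]
  exact mul_le_mul_of_nonneg_left (hu t) (pow_nonneg h0 t)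

lemma abs_tsum_geometric_mul_le {γ : ℝ} (h0 : 0 ≤ γ) (h1 : γ < 1) {u : ℕ → ℝ} {B : ℝ}
    (hu : ∀ t, |u t| ≤ B) : |∑' t, γ ^ t * u t| ≤ B / (1 - γ) := by
  have := tsum_of_norm_bounded (f := fun t => γ ^ t * u t)
    ((hasSum_geometric_of_lt_one h0 h1).mul_right B) fun t => by
      rw [norm_mul, norm_pow, Real.norm_of_nonneg h0]
      exact mul_le_mul_of_nonneg_left (hu t) (pow_nonneg h0 t)
  rw [div_eq_mul_inv, mul_comm]
  exact this

lemma integral_tsum_geometric {Ω : Type*} [MeasurableSpace Ω] (μ : Measure Ω)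
    [IsProbabilityMeasure μ] {γ : ℝ} (h0 : 0 ≤ γ) (h1 : γ < 1) {u : ℕ → Ω → ℝ} {B : ℝ}
    (hm : ∀ t, Measurable (u t)) (hu : ∀ t ω, |u t ω| ≤ B) :
    ∫ ω, ∑' t, γ ^ t * u t ω ∂μ = ∑' t, γ ^ t * ∫ ω, u t ω ∂μ := by
  have hb : ∀ t ω, ‖γ ^ t * u t ω‖ ≤ γ ^ t * B := fun t ω => by
    rw [norm_mul, norm_pow, Real.norm_of_nonneg h0]
    exact mul_le_mul_of_nonneg_left (hu t ω) (pow_nonneg h0 t)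
  have hi : ∀ t, Integrable (fun ω => γ ^ t * u t ω) μ := fun t =>
    Integrable.of_bound ((hm t).const_mul _).aestronglyMeasurable (γ ^ t * B)
      (Filter.Eventually.of_forall (hb t))
  rw [← integral_tsum_of_summable_integral_norm hi]
  · exact tsum_congr fun t => integral_const_mul _ _
  · refine Summable.of_nonneg_of_le (fun t => integral_nonneg fun _ => norm_nonneg _) (fun t => ?_)
      ((summable_geometric_of_lt_one h0 h1).mul_right B)
    refine (integral_mono (hi t).norm (integrable_const _) (hb t)).trans ?_
    simp

lemma mean_tsum_geometric (p : PMF α) {γ : ℝ} (h0 : 0 ≤ γ) (h1 : γ < 1) {u : ℕ → α → ℝ} {B : ℝ}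
    (hu : ∀ t x, |u t x| ≤ B) :
    mean p (fun x => ∑' t, γ ^ t * u t x) = ∑' t, γ ^ t * mean p (u t) := by
  let _ : MeasurableSpace α := ⊤
  have : DiscreteMeasurableSpace α := ⟨fun _ => trivial⟩
  have : IsProbabilityMeasure p.toMeasure := PMF.toMeasure.isProbabilityMeasure _
  rw [mean_eq_integral p ⟨_, fun x => abs_tsum_geometric_mul_le h0 h1 fun t => hu t x⟩,
    integral_tsum_geometric _ h0 h1 (fun t => measurable_from_top) hu]
  exact tsum_congr fun t => by rw [mean_eq_integral p ⟨B, hu t⟩]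

/-- The factor 2 undoes the 1/2 in `tvDist`. This is the only way model error enters the value
comparison. -/
lemma abs_mean_sub_mean_le (p q : PMF α) {f : α → ℝ} {B : ℝ} (hf : ∀ x, |f x| ≤ B) :
    |mean p f - mean q f| ≤ 2 * tvDist p q * B := by
  have hb : IsBdd f := ⟨B, hf⟩
  have hs : Summable fun x => |(p x).toReal - (q x).toReal| :=
    ((summable_toReal p).sub (summable_toReal q)).abs
  have h1 : mean p f - mean q f = ∑' x, ((p x).toReal - (q x).toReal) * f x := by
    rw [mean, mean, ← (hb.summable p).tsum_sub (hb.summable q)]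
    exact tsum_congr fun x => by ring
  rw [h1, tvDist, ← mul_assoc, mul_one_div_cancel two_ne_zero, one_mul, ← tsum_mul_right]
  refine tsum_of_norm_bounded (f := fun x => ((p x).toReal - (q x).toReal) * f x)
    (hs.mul_right B).hasSum fun x => ?_
  rw [norm_mul]
  exact mul_le_mul_of_nonneg_left (hf x) (abs_nonneg _)

/-- Total variation distance from one-sided bounds on a finite set carrying `q`. -/
lemma tvDist_le_card_mul (p q : PMF α) (T : Finset α) {ε : ℝ} (hT : ∀ x ∉ T, q x = 0)
    (hε : 0 ≤ ε) (h : ∀ x ∈ T, (q x).toReal - (p x).toReal ≤ ε) : tvDist p q ≤ T.card * ε := by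
  have hd := (summable_toReal p).sub (summable_toReal q)
  have hs : Summable fun x => |(p x).toReal - (q x).toReal| := hd.abs
  have h0 : ∑' x, ((p x).toReal - (q x).toReal) = 0 := by
    rw [(summable_toReal p).tsum_sub (summable_toReal q), tsum_toReal, tsum_toReal, sub_self]
  -- Both laws have mass 1, so the positive and negative parts of the difference have equal sums.
  -- This is why one-sided bounds suffice.
  have h1 : tvDist p q = ∑' x, max ((q x).toReal - (p x).toReal) 0 := by
    have h2 : ∑' x, |(p x).toReal - (q x).toReal| =
        ∑' x, (|(p x).toReal - (q x).toReal| - ((p x).toReal - (q x).toReal)) := by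
      rw [hs.tsum_sub hd, h0, sub_zero]
    rw [tvDist, h2, ← tsum_mul_left]
    refine tsum_congr fun x => ?_
    rcases le_total (p x).toReal (q x).toReal with h | h
    · rw [abs_of_nonpos (by linarith), max_eq_left (by linarith)]; ring
    · rw [abs_of_nonneg (by linarith), max_eq_right (by linarith)]; ring
  rw [h1, tsum_eq_sum (s := T)]
  · rw [← nsmul_eq_mul]
    exact Finset.sum_le_card_nsmul _ _ _ fun x hx => max_le (h x hx) hε
  · intro x hx
    rw [hT x hx]
    simp

end Mean

/-! ### Path measure, Markov property and Bellman equations. -/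

instance (p : PMF (StateAction S A)) : IsProbabilityMeasure p.toMeasure :=
  PMF.toMeasure.isProbabilityMeasure _

lemma mean_drawPair (ρ : PMF S) (π : Policy S A) {f : StateAction S A → ℝ} (hf : IsBdd f) :
    mean (drawPair ρ π) f = mean ρ fun s => mean (π s) fun a => f ⟨s, a⟩ := by
  rw [drawPair, mean_bind _ _ hf]
  simp only [mean_map _ _ hf]

namespace MDP

/-- The law of the next state-action pair. -/
def next (M : MDP S A) (π : Policy S A) (x : StateAction S A) : PMF (StateAction S A) :=
  drawPair (M.P x.state x.action) π

/-- Paths up to time `n`, frozen afterwards. -/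
lemma measurable_frozen (n : ℕ) : Measurable fun (h : Π _ : Finset.Iic n, StateAction S A) (i :
    ℕ) =>
    h ⟨min i n, Finset.mem_Iic.2 (min_le_right i n)⟩ :=
  measurable_pi_lambda _ fun _ => measurable_pi_apply _

/-- One-step Markov property of the path measure, for nonnegative functions. -/
lemma lintegral_path_succ (M : MDP S A) (ρ : PMF S) (π : Policy S A) (n : ℕ)
    {F : (ℕ → StateAction S A) → ENNReal} {G : StateAction S A × StateAction S A → ENNReal}
    (hF : Measurable F) (hFn : ∀ ω, F (fun i => ω (min i n)) = F ω) (hG : Measurable G) :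
    ∫⁻ ω, F ω * G (ω n, ω (n + 1)) ∂(M.pathFrom ρ π) =
      ∫⁻ ω, F ω * ∫⁻ y, G (ω n, y) ∂(M.next π (ω n)).toMeasure ∂(M.pathFrom ρ π) := by
  -- Invariance under freezing at time `n` says that `F` depends only on the history up to `n`. It
  -- therefore factors through the restriction, and the law of (history, next pair) is a
  -- composition-product.
  set F' : (Π _ : Finset.Iic n, StateAction S A) → ENNReal :=
    fun h => F fun i => h ⟨min i n, Finset.mem_Iic.2 (min_le_right i n)⟩ with hF'
  have hF'm : Measurable F' := hF.comp (measurable_frozen n)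
  have hFF : ∀ ω, F' (Preorder.frestrictLe n ω) = F ω := fun ω => hFn ω
  set H : (Π _ : Finset.Iic n, StateAction S A) × StateAction S A → ENNReal :=
    fun z => F' z.1 * G (z.1 ⟨n, Finset.mem_Iic.2 le_rfl⟩, z.2) with hH
  have hHm : Measurable H := (hF'm.comp measurable_fst).mul
    (hG.comp (((measurable_pi_apply _).comp measurable_fst).prodMk measurable_snd))
  have key := congrArg (fun μ => ∫⁻ z, H z ∂μ)
    (Kernel.map_frestrictLe_trajMeasure_compProd_eq_map_trajMeasure
      (X := fun _ => StateAction S A) (μ₀ := (drawPair ρ π).toMeasure) (κ := M.stepKernel π) (a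
          := n))
  beta_reduce at key
  rw [lintegral_map hHm (by fun_prop), Measure.lintegral_compProd hHm,
    lintegral_map (hHm.lintegral_kernel_prod_right') (by fun_prop)] at key
  simp only [hH, hFF] at key
  refine key.symm.trans (lintegral_congr fun ω => ?_)
  rw [lintegral_const_mul]
  · rfl
  · exact hG.comp (measurable_const.prodMk measurable_id)

/-- One-step Markov property of the path measure, for bounded functions. -/
lemma integral_path_succ (M : MDP S A) (ρ : PMF S) (π : Policy S A) (n : ℕ)
    {F : (ℕ → StateAction S A) → ℝ} {f : StateAction S A → ℝ}
    (hF : Measurable F) (hFb : IsBdd F) (hFn : ∀ ω, F (fun i => ω (min i n)) = F ω)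
    (hf : IsBdd f) :
    ∫ ω, F ω * f (ω (n + 1)) ∂(M.pathFrom ρ π) =
      ∫ ω, F ω * mean (M.next π (ω n)) f ∂(M.pathFrom ρ π) := by
  set F' : (Π _ : Finset.Iic n, StateAction S A) → ℝ :=
    fun h => F fun i => h ⟨min i n, Finset.mem_Iic.2 (min_le_right i n)⟩ with hF'
  have hF'm : Measurable F' := hF.comp (measurable_frozen n)
  have hFF : ∀ ω, F' (Preorder.frestrictLe n ω) = F ω := fun ω => hFn ω
  set H : (Π _ : Finset.Iic n, StateAction S A) × StateAction S A → ℝ :=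
    fun z => F' z.1 * f z.2 with hH
  have hHm : Measurable H := (hF'm.comp measurable_fst).mul
    (Measurable.of_discrete.comp measurable_snd)
  obtain ⟨B, hB⟩ := hFb
  obtain ⟨B', hB'⟩ := id hf
  have hHb : ∀ z, ‖H z‖ ≤ B * B' := fun z => by
    rw [hH, norm_mul]
    exact mul_le_mul (hB _) (hB' _) (norm_nonneg _) ((abs_nonneg _).trans (hB fun i => z.1 ⟨min
        i n, Finset.mem_Iic.2 (min_le_right i n)⟩))
  have key := congrArg (fun μ => ∫ z, H z ∂μ)
    (Kernel.map_frestrictLe_trajMeasure_compProd_eq_map_trajMeasure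
      (X := fun _ => StateAction S A) (μ₀ := (drawPair ρ π).toMeasure) (κ := M.stepKernel π) (a
          := n))
  beta_reduce at key
  have : IsProbabilityMeasure ((Kernel.trajMeasure (X := fun _ => StateAction S A)
      (drawPair ρ π).toMeasure (M.stepKernel π)).map (Preorder.frestrictLe n)) :=
    Measure.isProbabilityMeasure_map (by fun_prop)
  rw [integral_map (by fun_prop) hHm.aestronglyMeasurable, Measure.integral_compProd
      (Integrable.of_bound hHm.aestronglyMeasurable _ (Filter.Eventually.of_forall hHb)),
    integral_map (by fun_prop)
      (hHm.stronglyMeasurable.integral_kernel_prod_right').aestronglyMeasurable] at key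
  simp only [hH, hFF] at key
  refine key.symm.trans (integral_congr_ae (Filter.Eventually.of_forall fun ω => ?_))
  simp only
  rw [integral_const_mul, mean_eq_integral _ hf]
  rfl

lemma map_eval_zero_pathFrom (M : MDP S A) (ρ : PMF S) (π : Policy S A) :
    (M.pathFrom ρ π).map (fun ω => ω 0) = (drawPair ρ π).toMeasure := by
  have h1 : (fun ω : ℕ → StateAction S A => ω 0) =
      (fun h : Π _ : Finset.Iic 0, StateAction S A => h ⟨0, Finset.mem_Iic.2 le_rfl⟩) ∘
        Preorder.frestrictLe 0 := rfl
  rw [h1, ← Measure.map_map (by fun_prop) (by fun_prop), pathFrom, Kernel.trajMeasure,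
    Measure.map_comp _ _ (by fun_prop), Kernel.traj_map_frestrictLe, Kernel.partialTraj_self,
    Measure.id_comp, Measure.map_map (by fun_prop) (by fun_prop)]
  exact Measure.map_id

lemma integral_eval_zero (M : MDP S A) (ρ : PMF S) (π : Policy S A) {f : StateAction S A → ℝ}
    (hf : IsBdd f) : ∫ ω, f (ω 0) ∂(M.pathFrom ρ π) = mean (drawPair ρ π) f := by
  rw [mean_eq_integral _ hf, ← map_eval_zero_pathFrom M, integral_map (measurable_pi_apply
      0).aemeasurable
    Measurable.of_discrete.aestronglyMeasurable]

/-- Transition operator of the chain of pairs, multiplied by a weight `g`. -/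
def weightedStep (M : MDP S A) (π : Policy S A) (g f : StateAction S A → ℝ)
    (x : StateAction S A) : ℝ := g x * mean (M.next π x) f

lemma abs_weightedStep_le (M : MDP S A) (π : Policy S A) {g f : StateAction S A → ℝ} {B : ℝ}
    (hg : ∀ x, |g x| ≤ 1) (hf : ∀ x, |f x| ≤ B) (x : StateAction S A) :
    |M.weightedStep π g f x| ≤ B := by
  rw [weightedStep, abs_mul]
  calc |g x| * |mean (M.next π x) f| ≤ 1 * B :=
        mul_le_mul (hg x) (abs_mean_le _ hf) (abs_nonneg _) zero_le_one
    _ = B := one_mul B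

lemma abs_weightedStep_iterate_le (M : MDP S A) (π : Policy S A) {g f : StateAction S A → ℝ}
    {B : ℝ} (hg : ∀ x, |g x| ≤ 1) (hf : ∀ x, |f x| ≤ B) (t : ℕ) (x : StateAction S A) :
    |(M.weightedStep π g)^[t] f x| ≤ B := by
  induction t generalizing x with
  | zero => exact hf x
  | succ t ih =>
    rw [Function.iterate_succ_apply']
    exact M.abs_weightedStep_le π hg ih x

lemma abs_prod_le_one {g : StateAction S A → ℝ} (hg : ∀ x, |g x| ≤ 1) (t : ℕ)
    (ω : ℕ → StateAction S A) : |∏ i ∈ Finset.range t, g (ω i)| ≤ 1 := by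
  rw [Finset.abs_prod]
  exact Finset.prod_le_one (fun _ _ => abs_nonneg _) fun _ _ => hg _

lemma measurable_prod_eval (g : StateAction S A → ℝ) (t : ℕ) :
    Measurable fun ω : ℕ → StateAction S A => ∏ i ∈ Finset.range t, g (ω i) :=
  Finset.measurable_fun_prod _ fun i _ => Measurable.of_discrete.comp (measurable_pi_apply i)

/-- Integrating out the last coordinate by the Markov property turns `f` into `weightedStep g f` one
step earlier, so the induction generalizes `f`. The weight 1 gives expected rewards; the indicator
of `Uᶜ` kills the path after its first visit to `U`. -/
lemma integral_prod_mul_eval (M : MDP S A) (ρ : PMF S) (π : Policy S A)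
    {g f : StateAction S A → ℝ} (hg : ∀ x, |g x| ≤ 1) (hf : IsBdd f) (t : ℕ) :
    ∫ ω, (∏ i ∈ Finset.range t, g (ω i)) * f (ω t) ∂(M.pathFrom ρ π) =
      mean (drawPair ρ π) ((M.weightedStep π g)^[t] f) := by
  induction t generalizing f with
  | zero => simpa using M.integral_eval_zero ρ π hf
  | succ t ih =>
    obtain ⟨B, hB⟩ := id hf
    rw [integral_path_succ M ρ π t (measurable_prod_eval g (t + 1)) ⟨1, abs_prod_le_one hg _⟩ _ hf,
      Function.iterate_succ_apply, ← ih ⟨B, M.abs_weightedStep_le π hg hB⟩]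
    · refine integral_congr_ae (Filter.Eventually.of_forall fun ω => ?_)
      simp only [weightedStep, Finset.prod_range_succ, mul_assoc]
    · intro ω
      refine Finset.prod_congr rfl fun i hi => ?_
      beta_reduce
      rw [min_eq_left (Nat.lt_succ_iff.1 (Finset.mem_range.1 hi))]

/-- Discounted sum of the iterates of `weightedStep`. -/
def resolvent (M : MDP S A) (π : Policy S A) (g f : StateAction S A → ℝ) (x :
    StateAction S A) : ℝ :=
  ∑' t : ℕ, M.γ ^ t * (M.weightedStep π g)^[t] f x

section Resolvent

variable (M : MDP S A) (π : Policy S A) {g f : StateAction S A → ℝ} {B : ℝ}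

lemma abs_resolvent_le (h0 : 0 ≤ M.γ) (h1 : M.γ < 1) (hg : ∀ x, |g x| ≤ 1) (hf : ∀ x, |f x| ≤ B)
    (x : StateAction S A) : |M.resolvent π g f x| ≤ B / (1 - M.γ) :=
  abs_tsum_geometric_mul_le h0 h1 fun t => M.abs_weightedStep_iterate_le π hg hf t x

/-- Split off the term t = 0 and pull one step out of the remaining series. This one equation yields
the Bellman equations of both `Q` and `hitValue`. -/
lemma resolvent_eq (h0 : 0 ≤ M.γ) (h1 : M.γ < 1) (hg : ∀ x, |g x| ≤ 1) (hf : ∀ x, |f x| ≤ B)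
    (x : StateAction S A) :
    M.resolvent π g f x = f x + M.γ * (g x * mean (M.next π x) (M.resolvent π g f)) := by
  have hs := summable_geometric_mul h0 h1 fun t => M.abs_weightedStep_iterate_le π hg hf t x
  rw [resolvent, hs.tsum_eq_zero_add]
  simp only [pow_zero, Function.iterate_zero, id, one_mul]
  congr 1
  have : mean (M.next π x) (M.resolvent π g f) =
      ∑' t, M.γ ^ t * mean (M.next π x) ((M.weightedStep π g)^[t] f) :=
    mean_tsum_geometric _ h0 h1 fun t x => M.abs_weightedStep_iterate_le π hg hf t x
  rw [this, ← tsum_mul_left, ← tsum_mul_left]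
  refine tsum_congr fun t => ?_
  rw [Function.iterate_succ_apply', weightedStep]
  ring

lemma integral_tsum_prod_mul_eval (h0 : 0 ≤ M.γ) (h1 : M.γ < 1) (hg : ∀ x, |g x| ≤ 1)
    (hf : ∀ x, |f x| ≤ B) (ρ : PMF S) :
    ∫ ω, ∑' t : ℕ, M.γ ^ t * ((∏ i ∈ Finset.range t, g (ω i)) * f (ω t)) ∂(M.pathFrom ρ π) =
      mean (drawPair ρ π) (M.resolvent π g f) := by
  rw [integral_tsum_geometric (B := B) _ h0 h1]
  · have : mean (drawPair ρ π) (M.resolvent π g f) =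
        ∑' t, M.γ ^ t * mean (drawPair ρ π) ((M.weightedStep π g)^[t] f) :=
      mean_tsum_geometric _ h0 h1 fun t x => M.abs_weightedStep_iterate_le π hg hf t x
    rw [this]
    exact tsum_congr fun t => by rw [M.integral_prod_mul_eval ρ π hg ⟨B, hf⟩ t]
  · exact fun t => (measurable_prod_eval g t).mul
      (Measurable.of_discrete.comp (measurable_pi_apply t))
  · intro t ω
    rw [abs_mul]
    calc _ ≤ 1 * B := mul_le_mul (abs_prod_le_one hg t ω) (hf _) (abs_nonneg _) zero_le_one
      _ = B := one_mul B

end Resolvent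

/-- The state-action value function. -/
def Q (M : MDP S A) (π : Policy S A) : StateAction S A → ℝ :=
  M.resolvent π (fun _ => 1) fun x => M.r x.state x.action

section Value

variable (M : MDP S A) (π : Policy S A) {R : ℝ}

lemma abs_Q_le (h0 : 0 ≤ M.γ) (h1 : M.γ < 1) (hr : ∀ s a, |M.r s a| ≤ R) (x : StateAction S A) :
    |M.Q π x| ≤ R / (1 - M.γ) :=
  M.abs_resolvent_le π h0 h1 (by simp) (fun x => hr _ _) x

lemma Q_eq (h0 : 0 ≤ M.γ) (h1 : M.γ < 1) (hr : ∀ s a, |M.r s a| ≤ R) (x : StateAction S A) :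
    M.Q π x = M.r x.state x.action + M.γ * mean (M.next π x) (M.Q π) := by
  have := M.resolvent_eq π h0 h1 (g := fun _ => 1) (f := fun x => M.r x.state x.action) (by simp)
    (fun x => hr _ _) x
  simpa [Q] using this

lemma V_eq (h0 : 0 ≤ M.γ) (h1 : M.γ < 1) (hr : ∀ s a, |M.r s a| ≤ R) (s : S) :
    M.V π s = mean (π s) fun a => M.Q π ⟨s, a⟩ := by
  have h := M.integral_tsum_prod_mul_eval π h0 h1 (g := fun _ => 1)
    (f := fun x => M.r x.state x.action) (by simp) (fun x => hr _ _) (PMF.pure s)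
  simp only [Finset.prod_const_one, one_mul] at h
  rw [V, h, mean_drawPair _ _ ⟨_, M.abs_resolvent_le π h0 h1 (by simp) (fun x => hr _ _)⟩,
      mean_pure]
  rfl

lemma J_eq (h0 : 0 ≤ M.γ) (h1 : M.γ < 1) (hr : ∀ s a, |M.r s a| ≤ R) :
    M.J π = mean (drawPair M.ρ₀ π) (M.Q π) := by
  rw [mean_drawPair _ _ ⟨_, M.abs_Q_le π h0 h1 hr⟩]
  simp only [J, mean, M.V_eq π h0 h1 hr]

end Value

/-- The law of a single time of the path is a probability mass function. -/
lemma exists_pmf_map_eval (M : MDP S A) (ρ : PMF S) (π : Policy S A) (t : ℕ) :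
    ∃ p : PMF (StateAction S A), (M.pathFrom ρ π).map (fun ω => ω t) = p.toMeasure := by
  induction t with
  | zero => exact ⟨_, M.map_eval_zero_pathFrom ρ π⟩
  | succ t ih =>
    obtain ⟨p, hp⟩ := ih
    refine ⟨p.bind (M.next π), ?_⟩
    ext s hs
    rw [PMF.toMeasure_bind_apply _ _ _ hs, ← lintegral_indicator_one hs, lintegral_map
      (Measurable.of_discrete) (measurable_pi_apply _)]
    have h := M.lintegral_path_succ ρ π t (F := fun _ => 1)
      (G := fun z => s.indicator 1 z.2) measurable_const (fun _ => rfl)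
      ((Measurable.of_discrete (f := s.indicator 1)).comp measurable_snd)
    simp only [one_mul, lintegral_indicator_one hs] at h
    have h' := lintegral_map (μ := M.pathFrom ρ π) (f := fun x => (M.next π x).toMeasure s)
      (g := fun ω : ℕ → StateAction S A => ω t) Measurable.of_discrete (measurable_pi_apply _)
    -- No countability of `S` or `A` is assumed; the integral becomes a sum by restricting to the
    -- countable support of `p`.
    rw [h, ← h', hp, ← setLIntegral_univ, ← PMF.restrict_toMeasure_support,
        Measure.restrict_restrict MeasurableSet.univ, Set.univ_inter,
      lintegral_countable _ p.support_countable]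
    rw [tsum_subtype p.support (fun x => (M.next π x).toMeasure s * p.toMeasure {x})]
    refine tsum_congr fun x => ?_
    by_cases hx : x ∈ p.support
    · rw [Set.indicator_of_mem hx, PMF.toMeasure_apply_singleton _ _ (measurableSet_singleton _),
        mul_comm]
    · rw [Set.indicator_of_notMem hx, (PMF.apply_eq_zero_iff p x).2 hx, zero_mul]

end MDP

/-! ### Discounted iteration and hitting values. -/

/-- A bounded function that improves its own upper bounds by a discounted amount is bounded by
the resulting geometric series. -/
lemma le_of_discounted_bound {X : Type*} {Δ : X → ℝ} (hΔ : IsBdd Δ) {γ e : ℝ} (h0 : 0 ≤ γ)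
    (h1 : γ < 1) (he : 0 ≤ e) (h : ∀ K, 0 ≤ K → (∀ x, Δ x ≤ K) → ∀ x, Δ x ≤ γ * (K + e)) (x : X) :
    Δ x ≤ γ * e / (1 - γ) := by
  obtain ⟨B, hB⟩ := hΔ
  have hg : 0 < 1 - γ := by linarith
  set c := γ * e / (1 - γ) with hc
  have hc0 : 0 ≤ c := div_nonneg (mul_nonneg h0 he) hg.le
  -- `c` is the fixed point of K ↦ γ(K + e), so iterating from the crude bound |B| gives `c + γ ^ k
  -- * |B|`.
  have hcc : γ * (c + e) = c := by rw [hc]; field_simp; ring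
  have hit : ∀ k : ℕ, ∀ x, Δ x ≤ c + γ ^ k * |B| := by
    intro k
    induction k with
    | zero =>
      intro x
      have := (le_abs_self _).trans ((hB x).trans (le_abs_self B))
      simpa using by linarith
    | succ k ih =>
      intro x
      refine (h _ (by positivity) ih x).trans (le_of_eq ?_)
      calc γ * (c + γ ^ k * |B| + e) = γ * (c + e) + γ ^ (k + 1) * |B| := by ring
        _ = _ := by rw [hcc]
  have hlim : Filter.Tendsto (fun k : ℕ => c + γ ^ k * |B|) Filter.atTop (nhds (c + 0 * |B|)) :=
    tendsto_const_nhds.add ((tendsto_pow_atTop_nhds_zero_of_lt_one h0 h1).mul_const _)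
  simpa using ge_of_tendsto' hlim fun k => hit k x

namespace MDP

/-- Expected discount at the first visit to `U`, as a function of the initial pair. -/
def hitValue (M : MDP S A) (π : Policy S A) (U : Set (StateAction S A)) : StateAction S A → ℝ :=
  M.resolvent π (Uᶜ.indicator 1) (U.indicator 1)

lemma abs_indicator_one_le {α : Type*} (U : Set α) (x : α) : |U.indicator (1 : α → ℝ) x| ≤ 1 := by
  by_cases h : x ∈ U <;> simp [h]

section Hit

variable (M : MDP S A) (π : Policy S A) (U : Set (StateAction S A))

lemma isBdd_hitValue (h0 : 0 ≤ M.γ) (h1 : M.γ < 1) : IsBdd (M.hitValue π U) :=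
  ⟨_, M.abs_resolvent_le π h0 h1 (abs_indicator_one_le _) (abs_indicator_one_le _)⟩

lemma hitValue_of_mem (h0 : 0 ≤ M.γ) (h1 : M.γ < 1) {x : StateAction S A} (hx : x ∈ U) :
    M.hitValue π U x = 1 := by
  rw [hitValue, M.resolvent_eq π h0 h1 (abs_indicator_one_le _) (abs_indicator_one_le _)]
  simp [hx]

lemma hitValue_of_notMem (h0 : 0 ≤ M.γ) (h1 : M.γ < 1) {x : StateAction S A} (hx : x ∉ U) :
    M.hitValue π U x = M.γ * mean (M.next π x) (M.hitValue π U) := by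
  conv_lhs =>
    rw [hitValue, M.resolvent_eq π h0 h1 (abs_indicator_one_le _) (abs_indicator_one_le _)]
  simp [hx, hitValue]

end Hit

end MDP

/-! ### Comparison of the pessimistic and the true MDP. -/

section Pessimistic

variable (M : MDP S A) {R α : ℝ} (rhoHat : PMF S) (Phat : S → A → PMF S)
  (U : Set (StateAction S A)) (πp : Policy (Option S) A)

/-- A pair of the original MDP, seen in the pessimistic one. -/
def liftPair (x : StateAction S A) : StateAction (Option S) A := ⟨some x.state, x.action⟩

lemma drawPair_map_some (ρ : PMF S) :
    drawPair (ρ.map some) πp = (drawPair ρ fun s => πp (some s)).map liftPair := by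
  rw [drawPair, drawPair, PMF.bind_map, PMF.map_bind]
  congr 1
  funext s
  rw [PMF.map_comp]
  rfl

lemma pessimisticMDP_abs_r_le (hR : 0 ≤ R) (hr : ∀ s a, |M.r s a| ≤ R) (s : Option S) (a : A) :
    |(pessimisticMDP M.r M.γ R rhoHat Phat U).r s a| ≤ R := by
  cases s with
  | none => simp [pessimisticMDP, abs_of_nonneg hR]
  | some s => exact hr s a

lemma pessimisticMDP_Q_none (h0 : 0 ≤ M.γ) (h1 : M.γ < 1) (hR : 0 ≤ R)
    (hr : ∀ s a, |M.r s a| ≤ R) (a : A) :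
    (pessimisticMDP M.r M.γ R rhoHat Phat U).Q πp ⟨none, a⟩ = -(R / (1 - M.γ)) := by
  set N := pessimisticMDP M.r M.γ R rhoHat Phat U with hN
  have hrN := pessimisticMDP_abs_r_le M rhoHat Phat U hR hr
  set c := mean (πp none) fun a => N.Q πp ⟨none, a⟩ with hc
  have hq : ∀ a, N.Q πp ⟨none, a⟩ = -R + M.γ * c := by
    intro a
    rw [N.Q_eq πp h0 h1 hrN]
    have : N.next πp ⟨none, a⟩ = drawPair (PMF.pure none) πp := rfl
    rw [this, mean_drawPair _ _ ⟨_, N.abs_Q_le πp h0 h1 hrN⟩, mean_pure]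
    rfl
  -- Averaging the Bellman equation over the action at HALT leaves a scalar equation for `c`, whose
  -- solution is the least value possible under the reward bound.
  have hcc : c = -R + M.γ * c := by
    conv_lhs => rw [hc]
    simp only [hq, mean_const]
  have hg : (1 - M.γ) ≠ 0 := by linarith
  rw [hq, ← hcc]
  field_simp
  linarith

lemma pessimisticMDP_mean_Q_of_mem (h0 : 0 ≤ M.γ) (h1 : M.γ < 1) (hR : 0 ≤ R)
    (hr : ∀ s a, |M.r s a| ≤ R) {x : StateAction S A} (hx : x ∈ U) :
    (pessimisticMDP M.r M.γ R rhoHat Phat U).Q πp (liftPair x) =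
      M.r x.state x.action + M.γ * -(R / (1 - M.γ)) := by
  set N := pessimisticMDP M.r M.γ R rhoHat Phat U with hN
  have hrN := pessimisticMDP_abs_r_le M rhoHat Phat U hR hr
  rw [N.Q_eq πp h0 h1 hrN]
  have : N.next πp (liftPair x) = drawPair (PMF.pure none) πp := by
    simp [MDP.next, hN, pessimisticMDP, liftPair, hx]
  rw [this, mean_drawPair _ _ ⟨_, N.abs_Q_le πp h0 h1 hrN⟩, mean_pure]
  simp only [hN, pessimisticMDP_Q_none M rhoHat Phat U πp h0 h1 hR hr, mean_const]
  rfl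

lemma pessimisticMDP_mean_Q_of_notMem (h0 : 0 ≤ M.γ) (h1 : M.γ < 1) (hR : 0 ≤ R)
    (hr : ∀ s a, |M.r s a| ≤ R) {x : StateAction S A} (hx : x ∉ U) :
    (pessimisticMDP M.r M.γ R rhoHat Phat U).Q πp (liftPair x) =
      M.r x.state x.action + M.γ * mean (drawPair (Phat x.state x.action) fun s => πp (some s))
        fun y => (pessimisticMDP M.r M.γ R rhoHat Phat U).Q πp (liftPair y) := by
  set N := pessimisticMDP M.r M.γ R rhoHat Phat U with hN
  have hrN := pessimisticMDP_abs_r_le M rhoHat Phat U hR hr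
  rw [N.Q_eq πp h0 h1 hrN]
  have : N.next πp (liftPair x) = drawPair ((Phat x.state x.action).map some) πp := by
    simp [MDP.next, hN, pessimisticMDP, liftPair, hx]
  rw [this, drawPair_map_some, mean_map _ _ ⟨_, N.abs_Q_le πp h0 h1 hrN⟩]
  rfl

lemma pessimisticMDP_J_eq (h0 : 0 ≤ M.γ) (h1 : M.γ < 1) (hR : 0 ≤ R)
    (hr : ∀ s a, |M.r s a| ≤ R) :
    (pessimisticMDP M.r M.γ R rhoHat Phat U).J πp = mean (drawPair rhoHat fun s => πp (some s))
      fun y => (pessimisticMDP M.r M.γ R rhoHat Phat U).Q πp (liftPair y) := by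
  set N := pessimisticMDP M.r M.γ R rhoHat Phat U with hN
  have hrN := pessimisticMDP_abs_r_le M rhoHat Phat U hR hr
  rw [N.J_eq πp h0 h1 hrN]
  have : N.ρ₀ = rhoHat.map some := rfl
  rw [this, drawPair_map_some, mean_map _ _ ⟨_, N.abs_Q_le πp h0 h1 hrN⟩]

lemma abs_mean_drawPair_sub_le (p q : PMF S) (π : Policy S A) {f : StateAction S A → ℝ} {B : ℝ}
    (hf : ∀ x, |f x| ≤ B) :
    |mean (drawPair p π) f - mean (drawPair q π) f| ≤ 2 * tvDist p q * B := by
  rw [mean_drawPair _ _ ⟨B, hf⟩, mean_drawPair _ _ ⟨B, hf⟩]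
  exact abs_mean_sub_mean_le p q fun s => abs_mean_le _ fun a => hf _

variable {τ : ℝ}

/-- The pessimistic value of a policy exceeds its true value by at most the model error. -/
lemma pessimisticMDP_J_le (h0 : 0 ≤ M.γ) (h1 : M.γ < 1) (hR : 0 ≤ R) (hα : 0 ≤ α)
    (hr : ∀ s a, |M.r s a| ≤ R) (hτ : tvDist rhoHat M.ρ₀ ≤ τ) (hU : IsUSAD α M.P Phat U) :
    (pessimisticMDP M.r M.γ R rhoHat Phat U).J πp - M.J (fun s => πp (some s)) ≤
      2 * τ * (R / (1 - M.γ)) + M.γ * (2 * α * (R / (1 - M.γ))) / (1 - M.γ) := by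
  set N := pessimisticMDP M.r M.γ R rhoHat Phat U with hN
  set π : Policy S A := fun s => πp (some s) with hπ
  have hrN := pessimisticMDP_abs_r_le M rhoHat Phat U hR hr
  have hg : 0 < 1 - M.γ := by linarith
  set B := R / (1 - M.γ) with hB
  have hB0 : 0 ≤ B := div_nonneg hR hg.le
  have hNQ : ∀ y : StateAction S A, |N.Q πp (liftPair y)| ≤ B := fun y => N.abs_Q_le πp h0 h1 hrN _
  have hMQ : ∀ y, |M.Q π y| ≤ B := M.abs_Q_le π h0 h1 hr
  have hΔ : IsBdd fun y => N.Q πp (liftPair y) - M.Q π y := IsBdd.sub ⟨B, hNQ⟩ ⟨B, hMQ⟩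
  have key := le_of_discounted_bound hΔ h0 h1 (e := 2 * α * B) (by positivity) ?_
  · have hmean := mean_le (drawPair M.ρ₀ π) hΔ key
    rw [mean_sub _ ⟨B, hNQ⟩ ⟨B, hMQ⟩] at hmean
    have hd := (le_abs_self _).trans (abs_mean_drawPair_sub_le rhoHat M.ρ₀ π hNQ)
    have hτB := mul_le_mul_of_nonneg_right hτ hB0
    rw [hN, pessimisticMDP_J_eq M rhoHat Phat U πp h0 h1 hR hr, M.J_eq π h0 h1 hr]
    linarith
  · intro K hK hKb x
    rw [M.Q_eq π h0 h1 hr x]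
    by_cases hx : x ∈ U
    · rw [hN, pessimisticMDP_mean_Q_of_mem M rhoHat Phat U πp h0 h1 hR hr hx]
      -- On `U` the rewards agree and the pessimistic continuation is already minimal, so the
      -- difference is nonpositive.
      have h2 : -B ≤ mean (M.next π x) (M.Q π) := (abs_le.1 (abs_mean_le _ hMQ)).1
      have h3 : M.γ * -B ≤ M.γ * mean (M.next π x) (M.Q π) := mul_le_mul_of_nonneg_left h2 h0
      have : 0 ≤ M.γ * (K + 2 * α * B) := by positivity
      linarith
    · rw [hN, pessimisticMDP_mean_Q_of_notMem M rhoHat Phat U πp h0 h1 hR hr hx, ← hN]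
      have hd := (le_abs_self _).trans (abs_mean_drawPair_sub_le (Phat x.state x.action)
        (M.P x.state x.action) π hNQ)
      have hαB := mul_le_mul_of_nonneg_right (hU x.state x.action hx) hB0
      have hm := mean_le (M.next π x) hΔ hKb
      rw [mean_sub _ ⟨B, hNQ⟩ ⟨B, hMQ⟩] at hm
      -- Changing the transition law costs `2 * α * B`; under the common law `M.P` the remaining
      -- difference is at most `K`.
      have : mean (drawPair (Phat x.state x.action) π) (fun y => N.Q πp (liftPair y))
          - mean (M.next π x) (M.Q π) ≤ K + 2 * α * B := by
        rw [MDP.next] at hm ⊢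
        linarith
      have := mul_le_mul_of_nonneg_left this h0
      linarith

/-- The true value of a policy exceeds the pessimistic value of its extensions by at most the
model error and the expected loss from reaching HALT. -/
lemma J_sub_pessimisticMDP_J_le (h0 : 0 ≤ M.γ) (h1 : M.γ < 1) (hR : 0 ≤ R) (hα : 0 ≤ α)
    (hr : ∀ s a, |M.r s a| ≤ R) (hτ : tvDist rhoHat M.ρ₀ ≤ τ) (hU : IsUSAD α M.P Phat U) :
    M.J (fun s => πp (some s)) - (pessimisticMDP M.r M.γ R rhoHat Phat U).J πp ≤
      2 * (R / (1 - M.γ)) *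
        mean (drawPair M.ρ₀ fun s => πp (some s)) (M.hitValue (fun s => πp (some s)) U) +
      (2 * τ * (R / (1 - M.γ)) + M.γ * (2 * α * (R / (1 - M.γ))) / (1 - M.γ)) := by
  set N := pessimisticMDP M.r M.γ R rhoHat Phat U with hN
  set π : Policy S A := fun s => πp (some s) with hπ
  have hrN := pessimisticMDP_abs_r_le M rhoHat Phat U hR hr
  have hg : 0 < 1 - M.γ := by linarith
  set B := R / (1 - M.γ) with hB
  have hB0 : 0 ≤ B := div_nonneg hR hg.le
  have hNQ : ∀ y : StateAction S A, |N.Q πp (liftPair y)| ≤ B := fun y => N.abs_Q_le πp h0 h1 hrN _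
  have hMQ : ∀ y, |M.Q π y| ≤ B := M.abs_Q_le π h0 h1 hr
  have hh : IsBdd fun y => 2 * B * M.hitValue π U y := (M.isBdd_hitValue π U h0 h1).const_mul _
  have hΔ' : IsBdd fun y => M.Q π y - N.Q πp (liftPair y) := IsBdd.sub ⟨B, hMQ⟩ ⟨B, hNQ⟩
  -- The subtracted term equals 2B on `U`, enough to absorb any gap between two values. Off `U` it
  -- obeys the Bellman equation without reward, so it leaves the recursion of the difference intact.
  have hΔ : IsBdd fun y => M.Q π y - N.Q πp (liftPair y) - 2 * B * M.hitValue π U y := hΔ'.sub hh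
  have hmΔ : ∀ p, mean p (fun y => M.Q π y - N.Q πp (liftPair y) - 2 * B * M.hitValue π U y) =
      mean p (M.Q π) - mean p (fun y => N.Q πp (liftPair y)) - 2 * B * mean p (M.hitValue π U) := by
    intro p
    rw [mean_sub _ hΔ' hh, mean_sub _ ⟨B, hMQ⟩ ⟨B, hNQ⟩, mean_const_mul]
  have key := le_of_discounted_bound hΔ h0 h1 (e := 2 * α * B) (by positivity) ?_
  · have hmean := mean_le (drawPair M.ρ₀ π) hΔ key
    rw [hmΔ] at hmean
    have hd := (neg_le_abs _).trans (abs_mean_drawPair_sub_le rhoHat M.ρ₀ π hNQ)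
    have hτB := mul_le_mul_of_nonneg_right hτ hB0
    rw [hN, pessimisticMDP_J_eq M rhoHat Phat U πp h0 h1 hR hr, M.J_eq π h0 h1 hr]
    linarith
  · intro K hK hKb x
    rw [M.Q_eq π h0 h1 hr x]
    by_cases hx : x ∈ U
    · rw [hN, pessimisticMDP_mean_Q_of_mem M rhoHat Phat U πp h0 h1 hR hr hx,
        M.hitValue_of_mem π U h0 h1 hx]
      have h2 : mean (M.next π x) (M.Q π) ≤ B := (abs_le.1 (abs_mean_le _ hMQ)).2
      have h3 : M.γ * mean (M.next π x) (M.Q π) ≤ 1 * B :=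
        (mul_le_mul_of_nonneg_left h2 h0).trans (mul_le_mul_of_nonneg_right h1.le hB0)
      have h4 : M.γ * B ≤ 1 * B := mul_le_mul_of_nonneg_right h1.le hB0
      have : 0 ≤ M.γ * (K + 2 * α * B) := by positivity
      linarith
    · rw [hN, pessimisticMDP_mean_Q_of_notMem M rhoHat Phat U πp h0 h1 hR hr hx, ← hN,
        M.hitValue_of_notMem π U h0 h1 hx]
      have hd := (neg_le_abs _).trans (abs_mean_drawPair_sub_le (Phat x.state x.action)
        (M.P x.state x.action) π hNQ)
      have hαB := mul_le_mul_of_nonneg_right (hU x.state x.action hx) hB0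
      have hm := mean_le (M.next π x) hΔ hKb
      rw [hmΔ] at hm
      have : mean (M.next π x) (M.Q π) -
          mean (drawPair (Phat x.state x.action) π) (fun y => N.Q πp (liftPair y))
          - 2 * B * mean (M.next π x) (M.hitValue π U) ≤ K + 2 * α * B := by
        rw [MDP.next] at hm ⊢
        linarith
      have := mul_le_mul_of_nonneg_left this h0
      linarith

/-- Suboptimality of an output of the planner in the true MDP, against any policy. -/
lemma J_sub_J_output_le (h0 : 0 ≤ M.γ) (h1 : M.γ < 1) (hR : 0 ≤ R) (hα : 0 ≤ α)
    (hr : ∀ s a, |M.r s a| ≤ R) (hτ : tvDist rhoHat M.ρ₀ ≤ τ) (hU : IsUSAD α M.P Phat U) {ε : ℝ}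
    {πout : Policy S A} (hout : IsOutput M R ε rhoHat Phat U πout) (π : Policy S A) :
    M.J π - M.J πout ≤ ε + 2 * R / (1 - M.γ) * mean (drawPair M.ρ₀ π) (M.hitValue π U) +
      (4 * R / (1 - M.γ) * τ + 4 * M.γ * R / (1 - M.γ) ^ 2 * α) := by
  obtain ⟨πp, hsub, rfl⟩ := hout
  have : Nonempty S := ⟨M.ρ₀.support_nonempty.some⟩
  -- The behavior at HALT is irrelevant, so any extension of `π` can compete with the planner.
  set π' : Policy (Option S) A := fun s => s.elim (π (Classical.arbitrary S)) π with hπ'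
  have ha := pessimisticMDP_J_le M rhoHat Phat U πp h0 h1 hR hα hr hτ hU
  have hb := J_sub_pessimisticMDP_J_le M rhoHat Phat U π' h0 h1 hR hα hr hτ hU
  have hc := hsub π'
  have hg : 1 - M.γ ≠ 0 := by linarith
  have he : (fun s => π' (some s)) = π := rfl
  rw [he] at hb
  -- The model error is paid twice, once for each policy, which turns the factors 2 into 4.
  have e1 : 4 * R / (1 - M.γ) * τ + 4 * M.γ * R / (1 - M.γ) ^ 2 * α =
      2 * (2 * τ * (R / (1 - M.γ)) + M.γ * (2 * α * (R / (1 - M.γ))) / (1 - M.γ)) := by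
    field_simp
    ring
  have e2 : 2 * R / (1 - M.γ) = 2 * (R / (1 - M.γ)) := by ring
  rw [e1, e2]
  linarith

end Pessimistic

/-! ### Hitting times and the discounted visitation distribution. -/

lemma hittingTimeSet_le {U : Set (StateAction S A)} {ω : ℕ → StateAction S A} {t : ℕ}
    (h : ω t ∈ U) : hittingTimeSet U ω ≤ t :=
  (iInf₂_le (ω t) h).trans (iInf₂_le (f := fun (i : ℕ) (_ : ω i = ω t) => (i : ℕ∞)) t rfl)

lemma le_hittingTimeSet {U : Set (StateAction S A)} {ω : ℕ → StateAction S A} {m : ℕ∞}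
    (h : ∀ t : ℕ, ω t ∈ U → m ≤ t) : m ≤ hittingTimeSet U ω :=
  le_iInf₂ fun _ hx => le_iInf₂ fun t ht => h t (ht ▸ hx)

lemma measurableSet_eval_eq (t : ℕ) (x : StateAction S A) :
    MeasurableSet {ω : ℕ → StateAction S A | ω t = x} :=
  (measurable_pi_apply (X := fun _ : ℕ => StateAction S A) t) (measurableSet_singleton x)

lemma measurableSet_visited (x : StateAction S A) :
    MeasurableSet {z : (ℕ → StateAction S A) × ℕ | ∃ t < z.2, z.1 t = x} := by
  have : {z : (ℕ → StateAction S A) × ℕ | ∃ t < z.2, z.1 t = x} =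
      ⋃ t, {z | t < z.2} ∩ {z | z.1 t = x} := by
    ext z; simp
  rw [this]
  refine MeasurableSet.iUnion fun t => MeasurableSet.inter ?_ ?_
  · exact measurable_snd (MeasurableSet.of_discrete (s := {k : ℕ | t < k}))
  · exact measurable_fst (measurableSet_eval_eq t x)

/-- Only the term at the first visit survives: earlier terms have a zero indicator, later ones a
zero factor in the product. The series is the one computed by `resolvent`. -/
lemma discountPow_hittingTimeSet (γ : ℝ) (U : Set (StateAction S A)) (ω : ℕ → StateAction S A) :
    discountPow γ (hittingTimeSet U ω) = ∑' t : ℕ, γ ^ t *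
      ((∏ i ∈ Finset.range t, Uᶜ.indicator (1 : StateAction S A → ℝ) (ω i)) * U.indicator 1
          (ω t)) := by
  classical
  by_cases h : ∃ t, ω t ∈ U
  · have hT : hittingTimeSet U ω = (Nat.find h : ℕ) :=
      le_antisymm (hittingTimeSet_le (Nat.find_spec h))
        (le_hittingTimeSet fun t ht => by exact_mod_cast Nat.find_min' h ht)
    rw [hT, tsum_eq_single (Nat.find h)]
    · rw [Finset.prod_eq_one, Set.indicator_of_mem (Nat.find_spec h)]
      · simp [discountPow]
      · intro i hi
        rw [Set.indicator_of_mem]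
        · rfl
        · exact Nat.find_min h (Finset.mem_range.1 hi)
    · intro t ht
      rcases lt_or_gt_of_ne ht with hlt | hgt
      · rw [Set.indicator_of_notMem (Nat.find_min h hlt), mul_zero, mul_zero]
      · rw [Finset.prod_eq_zero (Finset.mem_range.2 hgt), zero_mul, mul_zero]
        exact Set.indicator_of_notMem (Set.notMem_compl_iff.2 (Nat.find_spec h)) _
  · push Not at h
    have hT : hittingTimeSet U ω = ⊤ :=
      top_le_iff.1 (le_hittingTimeSet fun t ht => absurd ht (h t))
    rw [hT]
    simp only [h, not_false_eq_true, Set.indicator_of_notMem, mul_zero, tsum_zero]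
    rfl

/-- The geometric distribution on `ℕ` with continuation probability `γ`. -/
def geomPMF (γ : ℝ) (h0 : 0 ≤ γ) (h1 : γ < 1) : PMF ℕ :=
  ⟨fun t => ENNReal.ofReal ((1 - γ) * γ ^ t), by
    have hn : ∀ t, 0 ≤ (1 - γ) * γ ^ t := fun t => mul_nonneg (by linarith) (pow_nonneg h0 t)
    have h := (hasSum_geometric_of_lt_one h0 h1).mul_left (1 - γ)
    rw [mul_inv_cancel₀ (by linarith)] at h
    have h' := ENNReal.ofReal_tsum_of_nonneg hn h.summable
    rw [h.tsum_eq, ENNReal.ofReal_one] at h'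
    exact h' ▸ ENNReal.summable.hasSum⟩

lemma mean_geomPMF (γ : ℝ) (h0 : 0 ≤ γ) (h1 : γ < 1) (u : ℕ → ℝ) :
    mean (geomPMF γ h0 h1) u = (1 - γ) * ∑' t, γ ^ t * u t := by
  rw [mean, ← tsum_mul_left]
  refine tsum_congr fun t => ?_
  have : geomPMF γ h0 h1 t = ENNReal.ofReal ((1 - γ) * γ ^ t) := rfl
  rw [this, ENNReal.toReal_ofReal (mul_nonneg (by linarith) (pow_nonneg h0 t)), mul_assoc]

lemma toReal_eq_mean_indicator {α : Type*} (p : PMF α) (x : α) :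
    (p x).toReal = mean p (({x} : Set α).indicator 1) := by
  classical
  rw [mean, tsum_eq_single x]
  · simp
  · intro y hy
    simp [hy]

namespace MDP

variable (M : MDP S A) (π : Policy S A)

instance : IsProbabilityMeasure (M.path π) := by unfold path; infer_instance

lemma expDiscountHitting_eq (h0 : 0 ≤ M.γ) (h1 : M.γ < 1) (U : Set (StateAction S A)) :
    M.expDiscountHitting π U = mean (drawPair M.ρ₀ π) (M.hitValue π U) := by
  simp only [expDiscountHitting, discountPow_hittingTimeSet]
  exact M.integral_tsum_prod_mul_eval π h0 h1 (abs_indicator_one_le _) (abs_indicator_one_le _) _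

/-- The discounted visitation distribution is a probability mass function. -/
lemma exists_visitation_pmf (h0 : 0 ≤ M.γ) (h1 : M.γ < 1) :
    ∃ d : PMF (StateAction S A), (∀ x, M.visitation π x = (d x).toReal) ∧
      ∀ f : StateAction S A → ℝ, IsBdd f →
        mean d f = (1 - M.γ) * ∑' t : ℕ, M.γ ^ t * ∫ ω, f (ω t) ∂(M.path π) := by
  choose p hp using fun t => M.exists_pmf_map_eval M.ρ₀ π t
  have hm : ∀ f : StateAction S A → ℝ, IsBdd f →
      mean ((geomPMF M.γ h0 h1).bind p) f =
        (1 - M.γ) * ∑' t : ℕ, M.γ ^ t * ∫ ω, f (ω t) ∂(M.path π) := by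
    intro f hf
    rw [mean_bind _ _ hf, mean_geomPMF]
    congr 1
    refine tsum_congr fun t => ?_
    rw [mean_eq_integral _ hf, ← hp, integral_map (measurable_pi_apply t).aemeasurable
      Measurable.of_discrete.aestronglyMeasurable]
    rfl
  -- The visitation distribution is the law of the pair seen at an independent geometric time.
  refine ⟨(geomPMF M.γ h0 h1).bind p, fun x => ?_, hm⟩
  rw [toReal_eq_mean_indicator, hm _ ⟨1, abs_indicator_one_le _⟩, visitation]
  congr 1
  refine tsum_congr fun t => ?_
  congr 1
  rw [← integral_indicator_one (measurableSet_eval_eq t x)]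
  rfl

lemma visitationSet_eq_mean {d : PMF (StateAction S A)} (hd : ∀ x, M.visitation π x = (d x).toReal)
    (U : Set (StateAction S A)) : M.visitationSet π U = mean d (U.indicator 1) := by
  rw [visitationSet, tsum_subtype U (M.visitation π), mean]
  refine tsum_congr fun x => ?_
  by_cases hx : x ∈ U <;> simp [hx, hd]

/-- The first visit is one of all visits: dropping the product of indicators, which is at most 1,
leaves the discounted expected number of visits to `U`. -/
lemma expDiscountHitting_le (h0 : 0 ≤ M.γ) (h1 : M.γ < 1) (U : Set (StateAction S A)) :
    M.expDiscountHitting π U ≤ M.visitationSet π U / (1 - M.γ) := by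
  obtain ⟨d, hd, hm⟩ := M.exists_visitation_pmf π h0 h1
  rw [visitationSet_eq_mean M π hd, hm _ ⟨1, abs_indicator_one_le _⟩,
    mul_div_cancel_left₀ _ (by linarith), expDiscountHitting]
  have hf : ∀ (t : ℕ) (ω : ℕ → StateAction S A),
      |(∏ i ∈ Finset.range t, Uᶜ.indicator (1 : StateAction S A → ℝ) (ω i)) * U.indicator 1 (ω
          t)| ≤ 1 := by
    intro t ω
    rw [abs_mul]
    exact mul_le_one₀ (abs_prod_le_one (abs_indicator_one_le _) t ω) (abs_nonneg _)
      (abs_indicator_one_le _ _)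
  have hpm : ∀ t : ℕ, Measurable fun ω : ℕ → StateAction S A =>
      (∏ i ∈ Finset.range t, Uᶜ.indicator (1 : StateAction S A → ℝ) (ω i)) * U.indicator 1 (ω t) :=
    fun t => (measurable_prod_eval (Uᶜ.indicator 1) t).mul
      ((Measurable.of_discrete (f := U.indicator 1)).comp (measurable_pi_apply t))
  have hmeas : ∀ t : ℕ, Measurable fun ω : ℕ → StateAction S A => U.indicator (1 : StateAction S
      A → ℝ) (ω t) :=
    fun t => (Measurable.of_discrete (f := U.indicator 1)).comp (measurable_pi_apply t)
  simp only [discountPow_hittingTimeSet]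
  rw [integral_tsum_geometric (B := 1) _ h0 h1 hpm hf]
  have hI : ∀ (t : ℕ) (u : (ℕ → StateAction S A) → ℝ), (∀ ω, |u ω| ≤ 1) →
      |∫ ω, u ω ∂(M.path π)| ≤ 1 := fun t u hu => by
    simpa using norm_integral_le_of_norm_le_const (μ := M.path π) (f := u) (C := 1)
        (Filter.Eventually.of_forall hu)
  refine Summable.tsum_le_tsum (fun t => mul_le_mul_of_nonneg_left ?_ (pow_nonneg h0 t))
    (summable_geometric_mul h0 h1 fun t => hI t _ (hf t))
    (summable_geometric_mul h0 h1 fun t => hI t _ fun ω => abs_indicator_one_le U (ω t))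
  refine integral_mono
    (Integrable.of_bound (hpm t).aestronglyMeasurable 1 (Filter.Eventually.of_forall (hf t)))
    (Integrable.of_bound (hmeas t).aestronglyMeasurable 1
      (Filter.Eventually.of_forall fun ω => abs_indicator_one_le U (ω t))) fun ω => ?_
  exact mul_le_of_le_one_left (Set.indicator_nonneg (fun _ _ => zero_le_one) _)
    ((le_abs_self _).trans (abs_prod_le_one (abs_indicator_one_le _) t ω))

lemma expDiscountHitting_nonpos (h0 : 0 ≤ M.γ) (h1 : M.γ < 1) {U : Set (StateAction S A)}
    (hU : ∀ x ∈ U, M.visitation π x = 0) : M.expDiscountHitting π U ≤ 0 := by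
  refine (M.expDiscountHitting_le π h0 h1 U).trans (le_of_eq ?_)
  have : M.visitationSet π U = 0 := by
    rw [visitationSet]
    simp [fun x : U => hU x x.2]
  rw [this, zero_div]

/-- A pair with positive probability at time t has visitation at least (1-γ)γ^t times it, which is
positive as γ > 0. Hence almost surely every recorded pair lies in the finite support of the
behavior visitation, where the union bounds are taken. -/
lemma ae_visitation_ne_zero (h0 : 0 < M.γ) (h1 : M.γ < 1) :
    ∀ᵐ ω ∂(M.path π), ∀ t, M.visitation π (ω t) ≠ 0 := by
  refine ae_all_iff.2 fun t => ?_
  obtain ⟨p, hp⟩ := M.exists_pmf_map_eval M.ρ₀ π t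
  have h : ∀ᵐ x ∂p.toMeasure, M.visitation π x ≠ 0 := by
    have hs : ∀ᵐ x ∂p.toMeasure, x ∈ p.support := by
      rw [ae_iff]
      exact (PMF.toMeasure_apply_eq_zero_iff p MeasurableSet.of_discrete).2
        (Set.disjoint_left.2 fun x hx hc => hc hx)
    filter_upwards [hs] with x hx
    have hpx : (M.path π).real {ω | ω t = x} = (p x).toReal := by
      rw [measureReal_def, ← PMF.toMeasure_apply_singleton p x (measurableSet_singleton x), ← hp,
        Measure.map_apply (measurable_pi_apply t) (measurableSet_singleton x)]
      rfl
    have hb : ∀ t, |(M.path π).real {ω | ω t = x}| ≤ 1 := fun t => by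
      rw [abs_of_nonneg measureReal_nonneg]; exact measureReal_le_one
    have hle := (summable_geometric_mul h0.le h1 hb).le_tsum t fun i _ =>
      mul_nonneg (pow_nonneg h0.le i) measureReal_nonneg
    rw [hpx] at hle
    have : 0 < (p x).toReal := ENNReal.toReal_pos ((PMF.mem_support_iff p x).1 hx)
        (p.apply_ne_top x)
    rw [visitation]
    have hpos : 0 < ∑' t : ℕ, M.γ ^ t * (M.path π).real {ω | ω t = x} :=
      lt_of_lt_of_le (by positivity) hle
    exact (mul_pos (by linarith) hpos).ne'
  rw [← hp] at h
  exact ae_of_ae_map (measurable_pi_apply t).aemeasurable h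

/-- A trajectory recorded for at least the effective horizon visits `x` with probability almost
`d(x)`. -/
lemma visitation_sub_le (h0 : 0 ≤ M.γ) (h1 : M.γ < 1) (len : PMF ℕ) {c : ℝ} (hc : 0 ≤ c)
    (hlen : ∀ t : ℕ, c < M.γ ^ t → M.γ ^ t ≤ len.toMeasure.real {k | t < k})
    (x : StateAction S A) :
    M.visitation π x - c ≤ ((M.path π).prod len.toMeasure).real {z | ∃ t < z.2, z.1 t = x} := by
  classical
  have : IsProbabilityMeasure len.toMeasure := PMF.toMeasure.isProbabilityMeasure _
  have hms := measurableSet_visited x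
  have hprod : ((M.path π).prod len.toMeasure).real {z | ∃ t < z.2, z.1 t = x} =
      ∫ ω, len.toMeasure.real {k | ∃ t < k, ω t = x} ∂(M.path π) := by
    rw [measureReal_def, Measure.prod_apply hms, ← integral_toReal]
    · rfl
    · exact (measurable_measure_prodMk_left hms).aemeasurable
    · exact Filter.Eventually.of_forall fun ω => measure_lt_top _ _
  have hmI : Measurable fun ω : ℕ → StateAction S A => len.toMeasure.real {k | ∃ t < k, ω t = x} :=
    (measurable_measure_prodMk_left hms).ennreal_toReal
  set I : ℕ → (ℕ → StateAction S A) → ℝ := fun t => {ω | ω t = x}.indicator 1 with hI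
  have hIm : ∀ t, Measurable (I t) := fun t =>
    measurable_one.indicator (measurableSet_eval_eq t x)
  have hIb : ∀ t ω, |I t ω| ≤ 1 := fun t ω => abs_indicator_one_le _ _
  have hvis : M.visitation π x = ∫ ω, (1 - M.γ) * ∑' t, M.γ ^ t * I t ω ∂(M.path π) := by
    rw [integral_const_mul, integral_tsum_geometric _ h0 h1 hIm hIb, visitation]
    congr 1
    refine tsum_congr fun t => ?_
    rw [hI, integral_indicator_one (measurableSet_eval_eq t x)]
  have hSm : Measurable fun ω => ∑' t, M.γ ^ t * I t ω :=
    Measurable.tsum fun t => (hIm t).const_mul _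
  have hSb : ∀ ω, |∑' t, M.γ ^ t * I t ω| ≤ 1 / (1 - M.γ) := fun ω =>
    abs_tsum_geometric_mul_le h0 h1 fun t => hIb t ω
  have hint : Integrable (fun ω => (1 - M.γ) * ∑' t, M.γ ^ t * I t ω) (M.path π) :=
    (Integrable.of_bound hSm.aestronglyMeasurable _ (Filter.Eventually.of_forall hSb)).const_mul _
  have hle : ∫ ω, ((1 - M.γ) * ∑' t, M.γ ^ t * I t ω) - c ∂(M.path π) ≤
      ∫ ω, len.toMeasure.real {k | ∃ t < k, ω t = x} ∂(M.path π) := by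
    refine integral_mono (hint.sub (integrable_const c)) (Integrable.of_bound
      hmI.aestronglyMeasurable 1 (Filter.Eventually.of_forall fun ω => ?_)) fun ω => ?_
    · rw [Real.norm_of_nonneg measureReal_nonneg]; exact measureReal_le_one
    · beta_reduce
      by_cases h : ∃ t, ω t = x
      · set T := Nat.find h with hT
        -- From the first visit `T` on, the normalized discounted visits add up to at most γ^T;
        -- given the path, recording step `T` already counts as a visit.
        have hsum : (1 - M.γ) * ∑' t, M.γ ^ t * I t ω ≤ M.γ ^ T := by
          have hs := summable_geometric_mul h0 h1 fun t => hIb t ω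
          have hz : ∑ t ∈ Finset.range T, M.γ ^ t * I t ω = 0 :=
            Finset.sum_eq_zero fun t ht => by
              have : ω t ≠ x := Nat.find_min h (Finset.mem_range.1 ht)
              simp [hI, this]
          rw [← hs.sum_add_tsum_nat_add T, hz, zero_add]
          have hle : ∑' t, M.γ ^ (t + T) * I (t + T) ω ≤ ∑' t, M.γ ^ t * M.γ ^ T := by
            refine Summable.tsum_le_tsum (fun t => ?_) ((summable_nat_add_iff T).2 hs)
              ((summable_geometric_of_lt_one h0 h1).mul_right _)
            rw [← pow_add]
            exact mul_le_of_le_one_right (pow_nonneg h0 _) ((le_abs_self _).trans (hIb _ _))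
          rw [tsum_mul_right, tsum_geometric_of_lt_one h0 h1] at hle
          calc (1 - M.γ) * ∑' t, M.γ ^ (t + T) * I (t + T) ω
              ≤ (1 - M.γ) * ((1 - M.γ)⁻¹ * M.γ ^ T) :=
                mul_le_mul_of_nonneg_left hle (by linarith)
            _ = M.γ ^ T := by
                rw [← mul_assoc, mul_inv_cancel₀ (by linarith), one_mul]
        have hsub : len.toMeasure.real {k | T < k} ≤ len.toMeasure.real {k | ∃ t < k, ω t = x} :=
          measureReal_mono fun k hk => ⟨T, hk, Nat.find_spec h⟩
        -- If γ^T exceeds `c`, the length assumption applies; otherwise the left side is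
        -- nonpositive.
        rcases lt_or_ge c (M.γ ^ T) with hcT | hcT
        · linarith [hlen T hcT]
        · have : 0 ≤ len.toMeasure.real {k | ∃ t < k, ω t = x} := measureReal_nonneg
          linarith
      · push Not at h
        have : ∀ t, I t ω = 0 := fun t => by simp [hI, h t]
        simp only [this, mul_zero, tsum_zero]
        exact (sub_nonpos.2 hc).trans measureReal_nonneg
  rw [integral_sub hint (integrable_const c), ← hvis] at hle
  simpa [hprod] using hle

end MDP

/-! ### Exponential moments and Hoeffding bounds for independent copies. -/

/-- Hoeffding's lemma for an event of probability at least `p`. -/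
lemma lintegral_exp_indicator_le_one {Ω : Type*} [MeasurableSpace Ω] (μ : Measure Ω)
    [IsProbabilityMeasure μ] {B : Set Ω} (hB : MeasurableSet B) {p l : ℝ} (hl : 0 ≤ l)
    (hp : p ≤ μ.real B) :
    ∫⁻ ω, ENNReal.ofReal (Real.exp (l * (p - B.indicator 1 ω) - l ^ 2 / 8)) ∂μ ≤ 1 := by
  have hX : Measurable (B.indicator (1 : Ω → ℝ)) := measurable_one.indicator hB
  have hmem : ∀ ω, B.indicator (1 : Ω → ℝ) ω ∈ Set.Icc (0 : ℝ) 1 := fun ω => by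
    by_cases h : ω ∈ B <;> simp [h]
  -- A variable with values in [0,1] has variance proxy 1/4, whence the compensator l²/8.
  have hsub := hasSubgaussianMGF_of_mem_Icc (μ := μ) hX.aemeasurable
    (Filter.Eventually.of_forall hmem)
  rw [integral_indicator_one hB] at hsub
  have hint := hsub.integrable_exp_mul (-l)
  have hle := hsub.mgf_le (-l)
  set X := B.indicator (1 : Ω → ℝ)
  have hi : Integrable (fun ω => Real.exp (-(l ^ 2 / 8)) * Real.exp (-l * (X ω - μ.real B))) μ :=
    hint.const_mul _
  calc ∫⁻ ω, ENNReal.ofReal (Real.exp (l * (p - X ω) - l ^ 2 / 8)) ∂μ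
      ≤ ∫⁻ ω, ENNReal.ofReal
          (Real.exp (-(l ^ 2 / 8)) * Real.exp (-l * (X ω - μ.real B))) ∂μ := by
        refine lintegral_mono fun ω => ENNReal.ofReal_le_ofReal ?_
        rw [← Real.exp_add]
        have := mul_le_mul_of_nonneg_left hp hl
        exact Real.exp_le_exp.2 (by linarith)
    _ = ENNReal.ofReal (Real.exp (-(l ^ 2 / 8)) * mgf (fun ω => X ω - μ.real B) μ (-l)) := by
        rw [← ofReal_integral_eq_lintegral_ofReal hi
          (Filter.Eventually.of_forall fun ω => by positivity), integral_const_mul]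
        rfl
    _ ≤ 1 := by
        rw [← ENNReal.ofReal_one]
        refine ENNReal.ofReal_le_ofReal ?_
        calc _ ≤ Real.exp (-(l ^ 2 / 8)) * _ :=
              mul_le_mul_of_nonneg_left hle (Real.exp_pos _).le
          _ = 1 := by
              rw [← Real.exp_add, ← Real.exp_zero]
              congr 1
              norm_num
              ring

/-- Chernoff bound for sums of independent copies. -/
lemma pi_real_le_exp_neg {Z : Type*} [MeasurableSpace Z] (μ : Measure Z) [IsProbabilityMeasure μ]
    {φ : Z → ℝ} (hφ : Measurable φ) (h : ∫⁻ z, ENNReal.ofReal (Real.exp (φ z)) ∂μ ≤ 1) (n : ℕ)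
    (c : ℝ) :
    (Measure.pi fun _ : Fin n => μ).real {ω | c ≤ ∑ i, φ (ω i)} ≤ Real.exp (-c) := by
  set f : Z → ENNReal := fun z => ENNReal.ofReal (Real.exp (φ z)) with hf
  have hfm : Measurable f := (Real.measurable_exp.comp hφ).ennreal_ofReal
  have hind : iIndepFun (fun (i : Fin n) (ω : Fin n → Z) => f (ω i))
      (Measure.pi fun _ : Fin n => μ) := iIndepFun_pi fun _ => hfm.aemeasurable
  have hprod : ∫⁻ ω, ∏ i, f (ω i) ∂(Measure.pi fun _ : Fin n => μ) ≤ 1 := by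
    rw [lintegral_prod_eq_prod_lintegral_of_indepFun _ _ hind
      fun i => hfm.comp (measurable_pi_apply i)]
    refine Finset.prod_le_one' fun i _ => ?_
    rw [(measurePreserving_eval (fun _ : Fin n => μ) i).lintegral_comp hfm]
    exact h
  have hmarkov := mul_meas_ge_le_lintegral (μ := Measure.pi fun _ : Fin n => μ)
    (f := fun ω => ∏ i, f (ω i))
    (Finset.measurable_fun_prod _ fun i _ => hfm.comp (measurable_pi_apply i))
    (ENNReal.ofReal (Real.exp c))
  have hset : {ω : Fin n → Z | ENNReal.ofReal (Real.exp c) ≤ ∏ i, f (ω i)} =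
      {ω | c ≤ ∑ i, φ (ω i)} := by
    ext ω
    simp only [Set.mem_ofPred_eq, hf]
    rw [← ENNReal.ofReal_prod_of_nonneg fun i _ => (Real.exp_pos _).le, ← Real.exp_sum,
      ENNReal.ofReal_le_ofReal_iff (Real.exp_pos _).le, Real.exp_le_exp]
  rw [hset] at hmarkov
  have hreal := ENNReal.toReal_mono ENNReal.one_ne_top (hmarkov.trans hprod)
  rw [ENNReal.toReal_mul, ENNReal.toReal_ofReal (Real.exp_pos _).le, ENNReal.toReal_one] at hreal
  rw [Real.exp_neg, measureReal_def]
  rwa [← one_div, le_div_iff₀' (Real.exp_pos _)]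

/-- One-sided Hoeffding inequality for the number of independent copies that lie in `B`. -/
lemma pi_real_hoeffding {Z : Type*} [MeasurableSpace Z] (μ : Measure Z) [IsProbabilityMeasure μ]
    {B : Set Z} (hB : MeasurableSet B) {p ε : ℝ} (hε : 0 ≤ ε) (hp : p ≤ μ.real B) (n : ℕ) :
    (Measure.pi fun _ : Fin n => μ).real {ω | ∑ i, B.indicator (1 : Z → ℝ) (ω i) ≤ n * (p - ε)} ≤
      Real.exp (-(2 * n * ε ^ 2)) := by
  -- The choice l = 4ε maximizes lε - l²/8, with value 2ε².
  have hm : Measurable fun z => 4 * ε * (p - B.indicator (1 : Z → ℝ) z) - (4 * ε) ^ 2 / 8 :=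
    ((measurable_const.sub (measurable_one.indicator hB)).const_mul _).sub_const _
  refine le_trans (measureReal_mono fun ω hω => ?_) (pi_real_le_exp_neg μ hm
    (lintegral_exp_indicator_le_one μ hB (by positivity) hp) n (2 * n * ε ^ 2))
  simp only [Set.mem_ofPred_eq] at hω ⊢
  rw [Finset.sum_sub_distrib, ← Finset.mul_sum, Finset.sum_sub_distrib]
  simp only [Finset.sum_const, Finset.card_univ, Fintype.card_fin, nsmul_eq_mul]
  have := mul_le_mul_of_nonneg_left hω hε
  nlinarith

/-! ### Exponential supermartingale for the transition counts. -/

/-- Recorded visits to `x` along one trajectory. -/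
def visits (x : StateAction S A) (z : (ℕ → StateAction S A) × ℕ) : ℕ :=
  open Classical in ((Finset.range z.2).filter fun t => z.1 t = x).card

/-- Recorded moves from `x` to `s'` along one trajectory. -/
def moves (x : StateAction S A) (s' : S) (z : (ℕ → StateAction S A) × ℕ) : ℕ :=
  open Classical in
  ((Finset.range z.2).filter fun t => z.1 t = x ∧ (z.1 (t + 1)).state = s').card

/-- Log-likelihood increment of the exponential supermartingale that controls the moves from `x`
to `s'`. -/
def increment (x : StateAction S A) (s' : S) (p l : ℝ) (y : StateAction S A ×
    StateAction S A) : ℝ :=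
  ({x} : Set (StateAction S A)).indicator 1 y.1 *
    (l * (p - (StateAction.state ⁻¹' {s'}).indicator 1 y.2) - l ^ 2 / 8)

lemma measurable_increment (x : StateAction S A) (s' : S) (p l : ℝ) :
    Measurable (increment (S := S) (A := A) x s' p l) := by
  have h1 : Measurable fun y : StateAction S A × StateAction S A =>
      ({x} : Set (StateAction S A)).indicator (1 : StateAction S A → ℝ) y.1 :=
    (Measurable.of_discrete (f := ({x} : Set (StateAction S A)).indicator (1 : StateAction S A →
        ℝ))).comp measurable_fst
  have h2 : Measurable fun y : StateAction S A × StateAction S A =>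
      (StateAction.state ⁻¹' {s'}).indicator (1 : StateAction S A → ℝ) y.2 :=
    (Measurable.of_discrete (f := (StateAction.state ⁻¹' {s'}).indicator
      (1 : StateAction S A → ℝ))).comp measurable_snd
  exact h1.mul (((measurable_const.sub h2).const_mul l).sub_const _)

lemma sum_increment (x : StateAction S A) (s' : S) (p l : ℝ) (z : (ℕ → StateAction S A) × ℕ) :
    ∑ t ∈ Finset.range z.2, increment x s' p l (z.1 t, z.1 (t + 1)) =
      l * (visits x z * p - moves x s' z) - visits x z * (l ^ 2 / 8) := by
  classical
  have h1 : (visits x z : ℝ) =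
      ∑ t ∈ Finset.range z.2, ({x} : Set (StateAction S A)).indicator (1 : StateAction S A → ℝ)
          (z.1 t) := by
    rw [visits, Finset.card_filter, Nat.cast_sum]
    refine Finset.sum_congr rfl fun t _ => ?_
    by_cases ha : z.1 t = x <;> simp [ha]
  have h2 : (moves x s' z : ℝ) =
      ∑ t ∈ Finset.range z.2, ({x} : Set (StateAction S A)).indicator (1 : StateAction S A → ℝ)
          (z.1 t) *
        (StateAction.state ⁻¹' {s'}).indicator (1 : StateAction S A → ℝ) (z.1 (t + 1)) := by
    rw [moves, Finset.card_filter, Nat.cast_sum]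
    refine Finset.sum_congr rfl fun t _ => ?_
    by_cases ha : z.1 t = x <;> by_cases hb : (z.1 (t + 1)).state = s' <;> simp [ha, hb]
  rw [h1, h2, Finset.sum_mul, Finset.sum_mul, ← Finset.sum_sub_distrib, Finset.mul_sum,
    ← Finset.sum_sub_distrib]
  refine Finset.sum_congr rfl fun t _ => ?_
  rw [increment]
  ring

namespace MDP

variable (M : MDP S A) (π : Policy S A)

lemma lintegral_next_increment (x : StateAction S A) (s' : S) {l : ℝ} (hl : 0 ≤ l)
    (y : StateAction S A) :
    ∫⁻ z, ENNReal.ofReal (Real.exp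
      (increment x s' (M.P x.state x.action s').toReal l (y, z))) ∂(M.next π y).toMeasure ≤ 1 := by
  by_cases hy : y = x
  · subst hy
    have hp : (M.P y.state y.action s').toReal ≤
        (M.next π y).toMeasure.real (StateAction.state ⁻¹' {s'}) := by
      rw [← integral_indicator_one MeasurableSet.of_discrete, ← mean_eq_integral _
        ⟨1, abs_indicator_one_le _⟩, next, mean_drawPair _ _ ⟨1, abs_indicator_one_le _⟩,
        toReal_eq_mean_indicator]
      refine le_of_eq ?_
      congr 1
      funext s
      exact (mean_const (π s) (({s'} : Set S).indicator 1 s)).symm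
    simpa [increment] using lintegral_exp_indicator_le_one (M.next π y).toMeasure
      MeasurableSet.of_discrete hl hp
  · simp [increment, hy]

/-- Given the history, the last factor has mean at most 1: it is trivial away from `x` and bounded
by Hoeffding's lemma at `x`. No independence between successive moves is needed. -/
lemma lintegral_prod_increment (ρ : PMF S) (x : StateAction S A) (s' : S) {l : ℝ} (hl : 0 ≤ l)
    (n : ℕ) :
    ∫⁻ ω, ∏ t ∈ Finset.range n, ENNReal.ofReal (Real.exp
      (increment x s' (M.P x.state x.action s').toReal l (ω t, ω (t + 1)))) ∂(M.pathFrom ρ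
          π) ≤ 1 := by
  set q : StateAction S A × StateAction S A → ENNReal := fun y =>
    ENNReal.ofReal (Real.exp (increment x s' (M.P x.state x.action s').toReal l y)) with hq
  have hqm : Measurable q := (Real.measurable_exp.comp (measurable_increment _ _ _
      _)).ennreal_ofReal
  induction n with
  | zero => simp
  | succ n ih =>
    simp only [Finset.prod_range_succ]
    have hF : Measurable fun ω : ℕ → StateAction S A =>
        ∏ t ∈ Finset.range n, q (ω t, ω (t + 1)) :=
      Finset.measurable_fun_prod _ fun t _ =>
        hqm.comp ((measurable_pi_apply t).prodMk (measurable_pi_apply (t + 1)))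
    have h := M.lintegral_path_succ ρ π n hF (fun ω => Finset.prod_congr rfl fun t ht => by
      have := Finset.mem_range.1 ht
      beta_reduce
      rw [min_eq_left (by omega), min_eq_left (by omega)]) hqm
    rw [h]
    refine (lintegral_mono fun ω => ?_).trans ih
    exact mul_le_of_le_one_right zero_le (M.lintegral_next_increment π x s' hl (ω n))

lemma measurable_sum_increment (x : StateAction S A) (s' : S) (p l : ℝ) :
    Measurable fun z : (ℕ → StateAction S A) × ℕ =>
      ∑ t ∈ Finset.range z.2, increment x s' p l (z.1 t, z.1 (t + 1)) :=
  measurable_from_prod_countable_left fun k =>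
    Finset.measurable_fun_sum (Finset.range k) fun t _ => (measurable_increment x s' p l).comp
      (f := fun ω : ℕ → StateAction S A => (ω t, ω (t + 1)))
      ((measurable_pi_apply t).prodMk (measurable_pi_apply (t + 1)))

/-- The length is independent of the path, so the bound for each fixed length can be averaged. -/
lemma lintegral_exp_sum_increment (len : PMF ℕ) (x : StateAction S A) (s' : S) {l : ℝ}
    (hl : 0 ≤ l) :
    ∫⁻ z, ENNReal.ofReal (Real.exp (∑ t ∈ Finset.range z.2,
      increment x s' (M.P x.state x.action s').toReal l (z.1 t, z.1 (t + 1))))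
        ∂((M.path π).prod len.toMeasure) ≤ 1 := by
  have : IsProbabilityMeasure len.toMeasure := PMF.toMeasure.isProbabilityMeasure _
  have hm : Measurable fun z : (ℕ → StateAction S A) × ℕ => ENNReal.ofReal (Real.exp
      (∑ t ∈ Finset.range z.2,
        increment x s' (M.P x.state x.action s').toReal l (z.1 t, z.1 (t + 1)))) :=
    (Real.measurable_exp.comp (measurable_sum_increment x s' _ l)).ennreal_ofReal
  rw [lintegral_prod_symm' _ hm]
  calc _ ≤ ∫⁻ _, 1 ∂len.toMeasure := by
        refine lintegral_mono fun k => ?_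
        simp only [Real.exp_sum]
        simp only [ENNReal.ofReal_prod_of_nonneg fun _ _ => (Real.exp_pos _).le]
        exact M.lintegral_prod_increment π M.ρ₀ x s' hl k
    _ = 1 := by simp

instance (len : PMF ℕ) (n : ℕ) : IsProbabilityMeasure (sampleLaw M π len n) := by
  have : IsProbabilityMeasure len.toMeasure := PMF.toMeasure.isProbabilityMeasure _
  unfold sampleLaw
  infer_instance

/-- Empirical transition frequencies from a pair with at least `m` recorded visits. -/
lemma sampleLaw_transition_le (len : PMF ℕ) (n : ℕ) (x : StateAction S A) (s' : S) {m ε : ℝ}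
    (hε : 0 ≤ ε) :
    (sampleLaw M π len n).real {ω | m ≤ ∑ i, (visits x (ω i) : ℝ) ∧
      ∑ i, (moves x s' (ω i) : ℝ) ≤
        (∑ i, (visits x (ω i) : ℝ)) * ((M.P x.state x.action s').toReal - ε)} ≤
      Real.exp (-(2 * m * ε ^ 2)) := by
  have : IsProbabilityMeasure len.toMeasure := PMF.toMeasure.isProbabilityMeasure _
  refine le_trans (measureReal_mono (μ := sampleLaw M π len n) fun ω hω => ?_)
    (pi_real_le_exp_neg _ (measurable_sum_increment x s' (M.P x.state x.action s').toReal (4 * ε))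
    (M.lintegral_exp_sum_increment π len x s' (by positivity)) n (2 * m * ε ^ 2))
  obtain ⟨h1, h2⟩ := hω
  simp only [Set.mem_ofPred_eq, sum_increment]
  rw [Finset.sum_sub_distrib, ← Finset.mul_sum, Finset.sum_sub_distrib, ← Finset.sum_mul,
    ← Finset.sum_mul]
  set N := ∑ i, (visits x (ω i) : ℝ)
  -- With l = 4ε and N visits, the exponent is at least 4ε·Nε - 2Nε² = 2Nε² ≥ 2mε². The random N
  -- thus needs no union bound over its values.
  have e1 := mul_le_mul_of_nonneg_left h2 hε
  have e2 := mul_le_mul_of_nonneg_right h1 (sq_nonneg ε)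
  nlinarith

end MDP

/-! ### Dataset statistics as sums over trajectories. -/

lemma empirical_toReal {α : Type*} [DecidableEq α] {l : Multiset α} (hl : l ≠ 0) (fb : PMF α) (a
    : α) :
    (empirical l fb a).toReal = (l.count a : ℝ) / l.card := by
  rw [empirical, dif_neg hl, PMF.ofMultiset_apply, ENNReal.toReal_div, ENNReal.toReal_natCast,
    ENNReal.toReal_natCast]
  congr!

lemma countP_trans {n : ℕ} (ω : Sample S A n) (p : StateAction S A × S → Prop) [DecidablePred p] :
    ω.dataset.trans.countP p = ∑ i, ((Finset.range (ω i).2).filter fun t =>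
      p ((ω i).1 t, ((ω i).1 (t + 1)).state)).card := by
  rw [Sample.dataset, ← Multiset.coe_countPAddMonoidHom, map_sum]
  refine Finset.sum_congr rfl fun i _ => ?_
  rw [Multiset.coe_countPAddMonoidHom, Multiset.countP_map]
  rfl

lemma count_dataset {n : ℕ} (ω : Sample S A n) (x : StateAction S A) :
    ω.dataset.count x = ∑ i, visits x (ω i) := by
  classical
  have h := countP_trans ω (fun y => y.1 = x)
  rw [Multiset.countP_eq_card_filter] at h
  rw [Dataset.count, Dataset.successors, Multiset.card_map]
  convert h using 2
  simp only [visits]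

lemma count_successors_dataset {n : ℕ} [DecidableEq S] (ω : Sample S A n) (x : StateAction S A)
    (s' : S) : (ω.dataset.successors x).count s' = ∑ i, moves x s' (ω i) := by
  classical
  have h := countP_trans ω (fun y => y.1 = x ∧ y.2 = s')
  rw [Dataset.successors, Multiset.count_map, Multiset.filter_filter]
  rw [Multiset.countP_eq_card_filter] at h
  convert h using 3
  · simp only [and_comm, eq_comm]
  · simp only [moves]
    congr!

lemma count_init_dataset {n : ℕ} [DecidableEq S] (ω : Sample S A n) (s : S) :
    (ω.dataset.init.count s : ℝ) =
      ∑ i, {z : (ℕ → StateAction S A) × ℕ | (z.1 0).state = s}.indicator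
        (1 : (ℕ → StateAction S A) × ℕ → ℝ) (ω i) := by
  classical
  rw [Sample.dataset, Multiset.count_map]
  rw [← Finset.filter_val, Finset.card_val, Finset.card_filter, Nat.cast_sum]
  refine Finset.sum_congr rfl fun i _ => ?_
  by_cases h : s = ((ω i).1 0).state
  · simp [h]
  · simp [h, Ne.symm h]

/-! ### Finite supports, union bounds and the good event. -/

/-- A probability mass function whose nonzero values are at least `c` has a finite support. -/
lemma exists_finset_support {α : Type*} (p : PMF α) {c : ℝ} (hc : 0 < c)
    (h : ∀ x, p x ≠ 0 → c ≤ (p x).toReal) :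
    ∃ T : Finset α, (∀ x, x ∈ T ↔ p x ≠ 0) ∧ T.card * c ≤ 1 := by
  have hle : ∀ T : Finset α, (∀ x ∈ T, p x ≠ 0) → T.card * c ≤ 1 := fun T hT =>
    calc T.card * c = ∑ x ∈ T, c := by rw [Finset.sum_const, nsmul_eq_mul]
      _ ≤ ∑ x ∈ T, (p x).toReal := Finset.sum_le_sum fun x hx => h x (hT x hx)
      _ ≤ 1 := tsum_toReal p ▸ (summable_toReal p).sum_le_tsum T fun _ _ => ENNReal.toReal_nonneg
  have hfin : {x | p x ≠ 0}.Finite := by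
    by_contra hinf
    obtain ⟨T, hT, hcard⟩ := Set.Infinite.exists_subset_card_eq hinf (⌊1 / c⌋₊ + 1)
    have h1 := hle T fun x hx => hT hx
    have h2 := Nat.lt_floor_add_one (1 / c)
    rw [hcard, ← le_div_iff₀ hc] at h1
    push_cast at h1
    linarith
  exact ⟨hfin.toFinset, fun x => by simp, hle _ fun x hx => by simpa using hx⟩

/-- The bad set need not be measurable; its measurable hull has the same measure, and the complement
of the hull serves as the event. -/
lemma exists_event_of_bad {Ω : Type*} [MeasurableSpace Ω] (μ : Measure Ω) [IsProbabilityMeasure μ]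
    (bad : Set Ω) {η : ℝ} (h : μ.real bad ≤ η) :
    ∃ E : Set Ω, MeasurableSet E ∧ 1 - η ≤ μ.real E ∧ ∀ ω ∈ E, ω ∉ bad := by
  refine ⟨(toMeasurable μ bad)ᶜ, (measurableSet_toMeasurable μ bad).compl, ?_, fun ω hω hb =>
    hω (subset_toMeasurable μ bad hb)⟩
  rw [probReal_compl_eq_one_sub (measurableSet_toMeasurable μ bad), measureReal_def,
    measure_toMeasurable, ← measureReal_def]
  linarith

lemma measureReal_biUnion_le_of_card {Ω ι : Type*} [MeasurableSpace Ω] (μ : Measure Ω)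
    [IsProbabilityMeasure μ] (T : Finset ι) (B : ι → Set Ω) {c η : ℝ} (hη : 0 ≤ η)
    (hT : T.card * c ≤ 1) (h : ∀ i ∈ T, μ.real (B i) ≤ η * c) : μ.real (⋃ i ∈ T, B i) ≤ η := by
  refine (measureReal_biUnion_finset_le T B).trans ((Finset.sum_le_card_nsmul _ _ _ h).trans ?_)
  rw [nsmul_eq_mul]
  calc (T.card : ℝ) * (η * c) = η * (T.card * c) := by ring
    _ ≤ η := mul_le_of_le_one_right hη hT

/-- Counting each trajectory at most once replaces dependent, unbounded visit counts by independent
0/1 variables, for which Hoeffding's inequality holds. -/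
lemma visited_indicator_le_visits (x : StateAction S A) (z : (ℕ → StateAction S A) × ℕ) :
    {z : (ℕ → StateAction S A) × ℕ | ∃ t < z.2, z.1 t = x}.indicator (1 : _ × ℕ → ℝ) z ≤
      visits x z := by
  classical
  by_cases h : ∃ t < z.2, z.1 t = x
  · obtain ⟨t, ht, hx⟩ := h
    have hz : z ∈ {z : (ℕ → StateAction S A) × ℕ | ∃ t < z.2, z.1 t = x} := ⟨t, ht, hx⟩
    rw [Set.indicator_of_mem hz, Pi.one_apply, visits, Nat.one_le_cast]
    exact Finset.card_pos.2 ⟨t, by simp [ht, hx]⟩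
  · have hz : z ∉ {z : (ℕ → StateAction S A) × ℕ | ∃ t < z.2, z.1 t = x} := h
    rw [Set.indicator_of_notMem hz]
    exact Nat.cast_nonneg _

/-- With high probability, all empirical frequencies of the sample are accurate. -/
lemma exists_good_event (M : MDP S A) (π : Policy S A) (len : PMF ℕ)
    {δ ρmin pmin dmin ε₀ ε : ℝ} (h0 : 0 < M.γ) (h1 : M.γ < 1) (hδ : 0 < δ)
    (hρmin : 0 < ρmin) (hpmin : 0 < pmin) (hdmin : 0 < dmin)
    (hρ : ∀ s, M.ρ₀ s ≠ 0 → ρmin ≤ (M.ρ₀ s).toReal)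
    (hp : ∀ s a s', M.P s a s' ≠ 0 → pmin ≤ (M.P s a s').toReal)
    (hd : ∀ x, M.visitation π x ≠ 0 → dmin ≤ M.visitation π x)
    (hlen : ∀ t : ℕ, dmin / 4 < M.γ ^ t → M.γ ^ t ≤ len.toMeasure.real {k | t < k})
    (n : ℕ) (hε₀ : 0 ≤ ε₀) (hε : 0 ≤ ε)
    (hb₀ : Real.exp (-(2 * n * ε₀ ^ 2)) ≤ δ * ρmin)
    (hb₁ : Real.exp (-(2 * n * (dmin / 4) ^ 2)) ≤ δ * dmin)
    (hb₂ : Real.exp (-(2 * (dmin * n / 2) * ε ^ 2)) ≤ δ * dmin * pmin) :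
    ∃ E : Set (Sample S A n), MeasurableSet E ∧ 1 - 3 * δ ≤ (sampleLaw M π len n).real E ∧
      ∀ ω ∈ E,
        (∀ s, M.ρ₀ s ≠ 0 → n * ((M.ρ₀ s).toReal - ε₀) ≤
          ∑ i, {z : (ℕ → StateAction S A) × ℕ | (z.1 0).state = s}.indicator
            (1 : (ℕ → StateAction S A) × ℕ → ℝ) (ω i)) ∧
        (∀ x, M.visitation π x ≠ 0 → dmin * n / 2 ≤ ∑ i, (visits x (ω i) : ℝ)) ∧
        (∀ x s', M.visitation π x ≠ 0 → M.P x.state x.action s' ≠ 0 →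
          dmin * n / 2 ≤ ∑ i, (visits x (ω i) : ℝ) →
          (∑ i, (visits x (ω i) : ℝ)) * ((M.P x.state x.action s').toReal - ε) ≤
            ∑ i, (moves x s' (ω i) : ℝ)) ∧
        ∀ i t, M.visitation π ((ω i).1 t) ≠ 0 := by
  have : IsProbabilityMeasure len.toMeasure := PMF.toMeasure.isProbabilityMeasure _
  obtain ⟨d, hdv, -⟩ := M.exists_visitation_pmf π h0.le h1
  obtain ⟨Tρ, hTρ, hTρc⟩ := exists_finset_support M.ρ₀ hρmin hρ
  have hd0 : ∀ x, M.visitation π x ≠ 0 ↔ d x ≠ 0 := fun x => by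
    rw [hdv, Ne, ENNReal.toReal_eq_zero_iff, or_iff_left (d.apply_ne_top x)]
  obtain ⟨Td, hTd, hTdc⟩ := exists_finset_support d hdmin fun x hx =>
    hdv x ▸ hd x ((hd0 x).2 hx)
  choose Tp hTp hTpc using fun x : StateAction S A =>
    exists_finset_support (M.P x.state x.action) hpmin (hp x.state x.action)
  set μ := sampleLaw M π len n with hμ
  set B₀ : S → Set (Sample S A n) := fun s =>
    {ω | ∑ i, {z : (ℕ → StateAction S A) × ℕ | (z.1 0).state = s}.indicator
      (1 : (ℕ → StateAction S A) × ℕ → ℝ) (ω i) ≤ n * ((M.ρ₀ s).toReal - ε₀)} with hB₀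
  -- One quarter of `dmin` is lost to finite recording, another quarter is the Hoeffding deviation;
  -- half remains.
  set B₁ : StateAction S A → Set (Sample S A n) := fun x =>
    {ω | ∑ i, {z : (ℕ → StateAction S A) × ℕ | ∃ t < z.2, z.1 t = x}.indicator
      (1 : (ℕ → StateAction S A) × ℕ → ℝ) (ω i) ≤ n * (3 / 4 * dmin - dmin / 4)} with hB₁
  set B₂ : StateAction S A → S → Set (Sample S A n) := fun x s' =>
    {ω | dmin * n / 2 ≤ ∑ i, (visits x (ω i) : ℝ) ∧ ∑ i, (moves x s' (ω i) : ℝ) ≤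
      (∑ i, (visits x (ω i) : ℝ)) * ((M.P x.state x.action s').toReal - ε)} with hB₂
  set N : Set (Sample S A n) := {ω | ¬ ∀ i t, M.visitation π ((ω i).1 t) ≠ 0} with hN
  have hm₀ : ∀ s, μ.real (B₀ s) ≤ δ * ρmin := fun s => by
    have hms : MeasurableSet {z : (ℕ → StateAction S A) × ℕ | (z.1 0).state = s} :=
      ((measurable_pi_apply (X := fun _ : ℕ => StateAction S A) 0).comp measurable_fst)
        (MeasurableSet.of_discrete (s := {y : StateAction S A | y.state = s}))
    refine le_trans (pi_real_hoeffding _ hms hε₀ (le_of_eq ?_) n) hb₀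
    have e1 : {z : (ℕ → StateAction S A) × ℕ | (z.1 0).state = s} =
        {ω : ℕ → StateAction S A | (ω 0).state = s} ×ˢ Set.univ := by ext; simp
    have e2 : (M.path π).real {ω : ℕ → StateAction S A | (ω 0).state = s} =
        (drawPair M.ρ₀ π).toMeasure.real (StateAction.state ⁻¹' {s}) := by
      rw [← M.map_eval_zero_pathFrom, map_measureReal_apply (measurable_pi_apply 0)
        MeasurableSet.of_discrete]
      rfl
    rw [e1, measureReal_prod_prod, probReal_univ, mul_one, e2,
      ← integral_indicator_one MeasurableSet.of_discrete, ← mean_eq_integral _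
      ⟨1, MDP.abs_indicator_one_le _⟩, mean_drawPair _ _ ⟨1, MDP.abs_indicator_one_le _⟩,
      toReal_eq_mean_indicator]
    congr 1
    funext s'
    exact (mean_const (π s') (({s} : Set S).indicator 1 s')).symm
  have hm₁ : ∀ x ∈ Td, μ.real (B₁ x) ≤ δ * dmin := fun x hx => by
    refine le_trans (pi_real_hoeffding _ (measurableSet_visited x) (by positivity) ?_ n) hb₁
    refine le_trans ?_ (M.visitation_sub_le π h0.le h1 len (by positivity) hlen x)
    linarith [hd x ((hd0 x).2 ((hTd x).1 hx))]
  have hm₂ : ∀ x s', μ.real (B₂ x s') ≤ δ * dmin * pmin := fun x s' =>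
    (M.sampleLaw_transition_le π len n x s' hε).trans hb₂
  have hmN : μ.real N = 0 := by
    have : ∀ᵐ ω ∂μ, ∀ i t, M.visitation π ((ω i).1 t) ≠ 0 := by
      refine ae_all_iff.2 fun i => ?_
      have hae : ∀ᵐ z ∂((M.path π).prod len.toMeasure), ∀ t, M.visitation π (z.1 t) ≠ 0 :=
        Measure.quasiMeasurePreserving_fst.ae (M.ae_visitation_ne_zero π h0 h1)
      exact (measurePreserving_eval (fun _ : Fin n => (M.path π).prod len.toMeasure) i
        ).quasiMeasurePreserving.ae hae
    rw [measureReal_def, ae_iff.1 this, ENNReal.toReal_zero]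
  -- Initial states, visits and transitions contribute δ each; `N` is null.
  have hbad : μ.real (((⋃ s ∈ Tρ, B₀ s) ∪ (⋃ x ∈ Td, B₁ x)) ∪
      ((⋃ x ∈ Td, ⋃ s' ∈ Tp x, B₂ x s') ∪ N)) ≤ 3 * δ := by
    have b₀ := measureReal_biUnion_le_of_card μ Tρ B₀ hδ.le hTρc fun s _ => hm₀ s
    have b₁ := measureReal_biUnion_le_of_card μ Td B₁ hδ.le hTdc hm₁
    have b₂ := measureReal_biUnion_le_of_card μ Td (fun x => ⋃ s' ∈ Tp x, B₂ x s') hδ.le hTdc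
      fun x _ => measureReal_biUnion_le_of_card μ (Tp x) (B₂ x) (by positivity) (hTpc x)
        fun s' _ => hm₂ x s'
    have u := measureReal_union_le (μ := μ) ((⋃ s ∈ Tρ, B₀ s) ∪ (⋃ x ∈ Td, B₁ x))
      ((⋃ x ∈ Td, ⋃ s' ∈ Tp x, B₂ x s') ∪ N)
    have u₁ := measureReal_union_le (μ := μ) (⋃ s ∈ Tρ, B₀ s) (⋃ x ∈ Td, B₁ x)
    have u₂ := measureReal_union_le (μ := μ) (⋃ x ∈ Td, ⋃ s' ∈ Tp x, B₂ x s') N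
    linarith
  obtain ⟨E, hE, hEm, hEb⟩ := exists_event_of_bad μ _ hbad
  refine ⟨E, hE, hEm, fun ω hω => ?_⟩
  have hn := hEb ω hω
  simp only [Set.mem_union, Set.mem_iUnion, not_or, not_exists] at hn
  obtain ⟨⟨hn₀, hn₁⟩, hn₂, hnN⟩ := hn
  refine ⟨fun s hs => ?_, fun x hx => ?_, fun x s' hx hs' hv => ?_, not_not.1 hnN⟩
  · exact (lt_of_not_ge (hn₀ s ((hTρ s).2 hs))).le
  · calc dmin * n / 2 = n * (3 / 4 * dmin - dmin / 4) := by ring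
      _ ≤ ∑ i, {z : (ℕ → StateAction S A) × ℕ | ∃ t < z.2, z.1 t = x}.indicator
          (1 : (ℕ → StateAction S A) × ℕ → ℝ) (ω i) :=
        (lt_of_not_ge (hn₁ x ((hTd x).2 ((hd0 x).1 hx)))).le
      _ ≤ _ := Finset.sum_le_sum fun i _ => visited_indicator_le_visits x (ω i)
  · by_contra hlt
    exact hn₂ x ((hTd x).2 ((hd0 x).1 hx)) s' ((hTp x s').2 hs') ⟨hv, (not_le.1 hlt).le⟩

/-! ### Guarantees on the good event. -/

/-- Total variation error of an empirical distribution with accurate frequencies. -/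
lemma tvDist_empirical_le {α : Type*} [DecidableEq α] {l : Multiset α} (hl : l ≠ 0) (fb p : PMF α)
    {c ε : ℝ} (hc : 0 < c) (hε : 0 ≤ ε) (hp : ∀ x, p x ≠ 0 → c ≤ (p x).toReal)
    (h : ∀ x, p x ≠ 0 → l.card * ((p x).toReal - ε) ≤ l.count x) :
    tvDist (empirical l fb) p ≤ ε / c := by
  obtain ⟨T, hT, hTc⟩ := exists_finset_support p hc hp
  have hl' : (0 : ℝ) < l.card := Nat.cast_pos.2 (Multiset.card_pos.2 hl)
  have := tvDist_le_card_mul (empirical l fb) p T (fun x hx => not_not.1 fun h => hx ((hT x).2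
      h)) hε
    fun x hx => by
      rw [empirical_toReal hl, sub_le_comm, le_div_iff₀' hl']
      exact h x ((hT x).1 hx)
  refine this.trans ?_
  rw [le_div_iff₀ hc]
  calc T.card * ε * c = T.card * c * ε := by ring
    _ ≤ ε := mul_le_of_le_one_left hε hTc

lemma tendsto_epsN (C Rmax γ δ ρmin pmin dmin : ℝ) :
    Filter.Tendsto (fun n : ℕ => epsN C Rmax γ δ ρmin pmin dmin n) Filter.atTop (nhds 0) := by
  have h1 : Filter.Tendsto (fun n : ℕ => √(Real.log (1 / (δ * ρmin)) / n)) Filter.atTop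
      (nhds 0) := by
    simpa using (tendsto_const_div_atTop_nhds_zero_nat (Real.log (1 / (δ * ρmin)))).sqrt
  have h2 : Filter.Tendsto (fun n : ℕ => √(Real.log (1 / (δ * pmin * dmin)) / (dmin * n)))
      Filter.atTop (nhds 0) := by
    have := (tendsto_const_div_atTop_nhds_zero_nat
      (Real.log (1 / (δ * pmin * dmin)) / dmin)).sqrt
    simpa [div_div] using this
  simpa [epsN] using (h1.const_mul (4 * C * Rmax / ((1 - γ) * ρmin))).add
    (h2.const_mul (4 * C * γ * Rmax / ((1 - γ) ^ 2 * pmin)))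

/-- Failure probabilities expressed through the logarithm of their bound. -/
lemma exp_neg_le_of_mul_log_le {y c z : ℝ} (hy : 0 < y) (hy1 : y ≤ 1) (hc : 1 ≤ c)
    (h : c * Real.log (1 / y) ≤ z) : Real.exp (-z) ≤ y := by
  rw [one_div, Real.log_inv] at h
  have hlog : Real.log y ≤ 0 := Real.log_nonpos hy.le hy1
  calc Real.exp (-z) ≤ Real.exp (Real.log y) := Real.exp_le_exp.2 (by nlinarith)
    _ = y := Real.exp_log hy

lemma pmf_toReal_le_one {α : Type*} (p : PMF α) (x : α) : (p x).toReal ≤ 1 :=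
  ENNReal.toReal_le_of_le_ofReal zero_le_one (by simpa using p.coe_le_one x)

/-- On a sample with accurate frequencies, the algorithm has its guarantees. -/
lemma guarantees_of_accurate (M : MDP S A) (πb : Policy S A)
    {Rmax C δ ρmin pmin dmin : ℝ} {n : ℕ} (h0 : 0 < M.γ) (h1 : M.γ < 1) (hC : 0 < C)
    (hr : ∀ s a, |M.r s a| ≤ Rmax) (hρmin : 0 < ρmin) (hpmin : 0 < pmin) (hdmin : 0 < dmin)
    (hρ : ∀ s, M.ρ₀ s ≠ 0 → ρmin ≤ (M.ρ₀ s).toReal)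
    (hp : ∀ s a s', M.P s a s' ≠ 0 → pmin ≤ (M.P s a s').toReal)
    (hn : 0 < n) (ω : Sample S A n)
    (g₀ : ∀ s, M.ρ₀ s ≠ 0 → n * ((M.ρ₀ s).toReal - C * √(Real.log (1 / (δ * ρmin)) / n)) ≤
      ∑ i, {z : (ℕ → StateAction S A) × ℕ | (z.1 0).state = s}.indicator
        (1 : (ℕ → StateAction S A) × ℕ → ℝ) (ω i))
    (g₁ : ∀ x, M.visitation πb x ≠ 0 → dmin * n / 2 ≤ ∑ i, (visits x (ω i) : ℝ))
    (g₂ : ∀ x s', M.visitation πb x ≠ 0 → M.P x.state x.action s' ≠ 0 →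
      dmin * n / 2 ≤ ∑ i, (visits x (ω i) : ℝ) →
      (∑ i, (visits x (ω i) : ℝ)) * ((M.P x.state x.action s').toReal -
        C * √(Real.log (1 / (δ * pmin * dmin)) / (dmin * n))) ≤ ∑ i, (moves x s' (ω i) : ℝ))
    (g₃ : ∀ i t, M.visitation πb ((ω i).1 t) ≠ 0) (ρfb : PMF S) (Pfb : S → A → PMF S) :
    IsUSAD (alphaN C δ pmin dmin n) M.P (ω.dataset.PHat Pfb)
        (ω.dataset.lowCount (dmin * n / 2)) ∧
      ∀ U : Set (StateAction S A), U ⊆ ω.dataset.lowCount (dmin * n / 2) →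
        IsUSAD (alphaN C δ pmin dmin n) M.P (ω.dataset.PHat Pfb) U →
        ∀ (επ : ℝ) (πout : Policy S A),
          IsOutput M Rmax επ (ω.dataset.rhoHat ρfb) (ω.dataset.PHat Pfb) U πout →
          M.J πb - M.J πout ≤ επ + epsN C Rmax M.γ δ ρmin pmin dmin n ∧
          ∀ πstar : Policy S A,
            M.J πstar - M.J πout ≤
                επ + 2 * Rmax / (1 - M.γ) * M.expDiscountHitting πstar U
                  + epsN C Rmax M.γ δ ρmin pmin dmin n ∧
            επ + 2 * Rmax / (1 - M.γ) * M.expDiscountHitting πstar U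
                  + epsN C Rmax M.γ δ ρmin pmin dmin n ≤
                επ + 2 * Rmax / (1 - M.γ) ^ 2 * M.visitationSet πstar U
                  + epsN C Rmax M.γ δ ρmin pmin dmin n := by
  classical
  have hg : 0 < 1 - M.γ := by linarith
  have hn' : (0 : ℝ) < n := Nat.cast_pos.2 hn
  have hm : 0 < dmin * n / 2 := by positivity
  have hR : 0 ≤ Rmax := by
    obtain ⟨s, -⟩ := M.ρ₀.support_nonempty
    obtain ⟨a, -⟩ := (πb s).support_nonempty
    exact (abs_nonneg _).trans (hr s a)
  set ε₀ := C * √(Real.log (1 / (δ * ρmin)) / n) with hε₀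
  set ε := C * √(Real.log (1 / (δ * pmin * dmin)) / (dmin * n)) with hε
  have hα : alphaN C δ pmin dmin n = ε / pmin := by rw [alphaN, hε]; ring
  have hcount : ∀ x, (ω.dataset.count x : ℝ) = ∑ i, (visits x (ω i) : ℝ) := fun x => by
    rw [count_dataset, Nat.cast_sum]
  have hτ : tvDist (ω.dataset.rhoHat ρfb) M.ρ₀ ≤ ε₀ / ρmin := by
    have hcard : ω.dataset.init.card = n := by simp [Sample.dataset]
    refine tvDist_empirical_le ?_ ρfb M.ρ₀ hρmin (by positivity) hρ fun s hs => ?_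
    · rw [← Multiset.card_pos, hcard]; exact hn
    · rw [hcard, count_init_dataset]
      exact g₀ s hs
  have husad : IsUSAD (alphaN C δ pmin dmin n) M.P (ω.dataset.PHat Pfb)
      (ω.dataset.lowCount (dmin * n / 2)) := by
    intro s a hsa
    have hc : dmin * n / 2 ≤ (ω.dataset.count ⟨s, a⟩ : ℝ) := not_lt.1 hsa
    have hpos : 0 < ω.dataset.count ⟨s, a⟩ := Nat.cast_pos.1 (hm.trans_le hc)
    -- A positive count means that the pair occurs on a sampled path, so `g₃` puts it in the support
    -- where `g₂` applies.
    have hvis : M.visitation πb ⟨s, a⟩ ≠ 0 := by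
      rw [count_dataset] at hpos
      obtain ⟨i, -, hi⟩ := Finset.exists_ne_zero_of_sum_ne_zero hpos.ne'
      obtain ⟨t, ht⟩ := Finset.card_ne_zero.1 hi
      exact (Finset.mem_filter.1 ht).2 ▸ g₃ i t
    rw [hα]
    refine tvDist_empirical_le (Multiset.card_pos.1 hpos) (Pfb s a) (M.P s a) hpmin (by positivity)
      (hp s a) fun s' hs' => ?_
    rw [count_successors_dataset, Nat.cast_sum]
    have := g₂ ⟨s, a⟩ s' hvis hs' (hcount ⟨s, a⟩ ▸ hc)
    rwa [← hcount] at this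
  refine ⟨husad, fun U hUsub hU επ πout hout => ?_⟩
  have hα0 : 0 ≤ alphaN C δ pmin dmin n := by rw [hα]; positivity
  have heps : 4 * Rmax / (1 - M.γ) * (ε₀ / ρmin) +
      4 * M.γ * Rmax / (1 - M.γ) ^ 2 * alphaN C δ pmin dmin n =
        epsN C Rmax M.γ δ ρmin pmin dmin n := by
    rw [hα, epsN, hε₀, hε]
    field_simp
  have main : ∀ π, M.J π - M.J πout ≤
      επ + 2 * Rmax / (1 - M.γ) * M.expDiscountHitting π U
        + epsN C Rmax M.γ δ ρmin pmin dmin n := fun π => by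
    rw [M.expDiscountHitting_eq π h0.le h1, ← heps]
    exact J_sub_J_output_le M _ _ U h0.le h1 hR hα0 hr hτ hU hout π
  have hk : 0 ≤ 2 * Rmax / (1 - M.γ) := by positivity
  refine ⟨?_, fun πstar => ⟨main πstar, ?_⟩⟩
  -- Pairs of `U` have counts below the threshold, so by `g₁` the behavior policy never charges
  -- them.
  · have hz := M.expDiscountHitting_nonpos πb h0.le h1 (U := U) fun x hx => by
      by_contra hvis
      have hlt : (ω.dataset.count x : ℝ) < dmin * n / 2 := hUsub hx
      rw [hcount] at hlt
      exact absurd (g₁ x hvis) (not_le.2 hlt)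
    linarith [main πb, mul_nonpos_of_nonneg_of_nonpos hk hz]
  · have := mul_le_mul_of_nonneg_left (M.expDiscountHitting_le πstar h0.le h1 U) hk
    have e : 2 * Rmax / (1 - M.γ) * (M.visitationSet πstar U / (1 - M.γ)) =
        2 * Rmax / (1 - M.γ) ^ 2 * M.visitationSet πstar U := by
      field_simp
    linarith

end MOReL

end

/-! ### Choice of constants and conclusion. -/

theorem lemma2 :
    ∃ C₀ : ℝ, 0 < C₀ ∧ ∀ C : ℝ, C₀ ≤ C →
    ∀ (S : Type*) (A : Type*) (M : MOReL.MDP S A) (Rmax : ℝ)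
      (πb : MOReL.Policy S A) (len : PMF ℕ) (δ ρmin pmin dmin : ℝ),
    0 < M.γ → M.γ < 1 →
    (∀ s a, |M.r s a| ≤ Rmax) →
    0 < δ → δ < 1 →
    -- smallest non-zero values of `ρ₀`, of the transition probabilities, and of `d^{πb}`
    IsLeast {x : ℝ | x ≠ 0 ∧ ∃ s, x = (M.ρ₀ s).toReal} ρmin →
    IsLeast {x : ℝ | x ≠ 0 ∧ ∃ s a s', x = (M.P s a s').toReal} pmin →
    IsLeast {x : ℝ | x ≠ 0 ∧ ∃ y, x = M.visitation πb y} dmin →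
    -- trajectories are recorded for at least the effective horizon: step `t` is recorded with
    -- probability at least `γ ^ t`, unless `γ ^ t` is negligible
    (∀ t : ℕ, dmin / 4 < M.γ ^ t → M.γ ^ t ≤ len.toMeasure.real {k | t < k}) →
    -- the error term vanishes as the number of trajectories grows
    Filter.Tendsto (fun n : ℕ => MOReL.epsN C Rmax M.γ δ ρmin pmin dmin n) Filter.atTop (nhds 0) ∧
    ∀ n : ℕ, C / dmin ^ 2 * Real.log (1 / (δ * dmin)) ≤ n →
    ∃ E : Set (MOReL.Sample S A n), MeasurableSet E ∧
      1 - C * δ ≤ (MOReL.sampleLaw M πb len n).real E ∧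
      ∀ ω ∈ E, ∀ (ρfb : PMF S) (Pfb : S → A → PMF S),
        -- the count-based detector is a correct `α`-USAD
        MOReL.IsUSAD (MOReL.alphaN C δ pmin dmin n) M.P (ω.dataset.PHat Pfb)
            (ω.dataset.lowCount (dmin * n / 2)) ∧
        -- guarantees for it, and for any correct `α`-USAD that flags no more pairs as unknown
        ∀ U : Set (MOReL.StateAction S A),
          U ⊆ ω.dataset.lowCount (dmin * n / 2) →
          MOReL.IsUSAD (MOReL.alphaN C δ pmin dmin n) M.P (ω.dataset.PHat Pfb) U →
          ∀ (επ : ℝ) (πout : MOReL.Policy S A),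
            MOReL.IsOutput M Rmax επ (ω.dataset.rhoHat ρfb) (ω.dataset.PHat Pfb) U πout →
            M.J πb - M.J πout ≤ επ + MOReL.epsN C Rmax M.γ δ ρmin pmin dmin n ∧
            ∀ πstar : MOReL.Policy S A, M.IsOptimal πstar →
              M.J πstar - M.J πout ≤
                  επ + 2 * Rmax / (1 - M.γ) * M.expDiscountHitting πstar U
                    + MOReL.epsN C Rmax M.γ δ ρmin pmin dmin n ∧
              επ + 2 * Rmax / (1 - M.γ) * M.expDiscountHitting πstar U
                    + MOReL.epsN C Rmax M.γ δ ρmin pmin dmin n ≤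
                  επ + 2 * Rmax / (1 - M.γ) ^ 2 * M.visitationSet πstar U
                    + MOReL.epsN C Rmax M.γ δ ρmin pmin dmin n := by
  -- The value 8 comes from the visit counts: 2n(dmin/4)² = n·dmin²/8 is at least
  -- (C/8)·log(1/(δ·dmin)). The other bounds only need 2C² ≥ 1, C² ≥ 1 and C ≥ 3.
  refine ⟨8, by norm_num, fun C hC S A M Rmax πb len δ ρmin pmin dmin h0 h1 hr hδ hδ1 hρ hp hd
    hlen => ⟨MOReL.tendsto_epsN _ _ _ _ _ _ _, fun n hn => ?_⟩⟩
  obtain ⟨⟨hρne, s₀, hs₀⟩, hρlb⟩ := hρ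
  obtain ⟨⟨hpne, s₁, a₁, s₂, hs₂⟩, hplb⟩ := hp
  obtain ⟨⟨hdne, y₀, hy₀⟩, hdlb⟩ := hd
  obtain ⟨d, hdv, -⟩ := M.exists_visitation_pmf πb h0.le h1
  have hρ0 : 0 < ρmin := lt_of_le_of_ne (hs₀ ▸ ENNReal.toReal_nonneg) (Ne.symm hρne)
  have hρ1 : ρmin ≤ 1 := hs₀ ▸ MOReL.pmf_toReal_le_one _ _
  have hp0 : 0 < pmin := lt_of_le_of_ne (hs₂ ▸ ENNReal.toReal_nonneg) (Ne.symm hpne)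
  have hp1 : pmin ≤ 1 := hs₂ ▸ MOReL.pmf_toReal_le_one _ _
  rw [hdv] at hy₀
  have hd0 : 0 < dmin := lt_of_le_of_ne (hy₀ ▸ ENNReal.toReal_nonneg) (Ne.symm hdne)
  have hd1 : dmin ≤ 1 := hy₀ ▸ MOReL.pmf_toReal_le_one _ _
  have hC0 : 0 < C := by linarith
  have hρlb' : ∀ s, M.ρ₀ s ≠ 0 → ρmin ≤ (M.ρ₀ s).toReal := fun s hs =>
    hρlb ⟨ENNReal.toReal_ne_zero.2 ⟨hs, PMF.apply_ne_top _ _⟩, s, rfl⟩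
  have hplb' : ∀ s a s', M.P s a s' ≠ 0 → pmin ≤ (M.P s a s').toReal := fun s a s' hs =>
    hplb ⟨ENNReal.toReal_ne_zero.2 ⟨hs, PMF.apply_ne_top _ _⟩, s, a, s', rfl⟩
  have hdlb' : ∀ x, M.visitation πb x ≠ 0 → dmin ≤ M.visitation πb x := fun x hx =>
    hdlb ⟨hx, x, rfl⟩
  have hy₁ : δ * dmin < 1 := mul_lt_one_of_nonneg_of_lt_one_left hδ.le hδ1 hd1
  have hL₁ : 0 < Real.log (1 / (δ * dmin)) :=
    Real.log_pos ((one_lt_div (by positivity)).2 hy₁)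
  -- Since δ < 1 makes the logarithm strictly positive, the sample size condition excludes n = 0.
  have hn0 : (0 : ℝ) < n := lt_of_lt_of_le (by positivity) hn
  have hy₀' : δ * ρmin ≤ 1 := mul_le_one₀ hδ1.le hρ0.le hρ1
  have hy₂ : δ * pmin * dmin ≤ 1 :=
    mul_le_one₀ (mul_le_one₀ hδ1.le hp0.le hp1) hd0.le hd1
  have hL₀ : 0 ≤ Real.log (1 / (δ * ρmin)) :=
    Real.log_nonneg ((one_le_div (by positivity)).2 hy₀')
  have hL₂ : 0 ≤ Real.log (1 / (δ * pmin * dmin)) :=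
    Real.log_nonneg ((one_le_div (by positivity)).2 hy₂)
  have hb₀ : Real.exp (-(2 * n * (C * √(Real.log (1 / (δ * ρmin)) / n)) ^ 2)) ≤ δ * ρmin := by
    refine MOReL.exp_neg_le_of_mul_log_le (c := 2 * C ^ 2) (by positivity) hy₀' (by nlinarith)
      (le_of_eq ?_)
    rw [mul_pow, Real.sq_sqrt (by positivity)]
    field_simp
  have hb₁ : Real.exp (-(2 * n * (dmin / 4) ^ 2)) ≤ δ * dmin := by
    refine MOReL.exp_neg_le_of_mul_log_le (c := C / 8) (by positivity) hy₁.le (by linarith) ?_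
    rw [div_mul_eq_mul_div, div_le_iff₀ (by positivity)] at hn
    linarith
  have hb₂ : Real.exp (-(2 * (dmin * n / 2) *
      (C * √(Real.log (1 / (δ * pmin * dmin)) / (dmin * n))) ^ 2)) ≤ δ * dmin * pmin := by
    rw [mul_right_comm δ dmin pmin]
    refine MOReL.exp_neg_le_of_mul_log_le (c := C ^ 2) (by positivity) hy₂ (by nlinarith)
      (le_of_eq ?_)
    rw [mul_pow, Real.sq_sqrt (by positivity)]
    field_simp
  obtain ⟨E, hE, hEm, hEg⟩ := MOReL.exists_good_event M πb len h0 h1 hδ hρ0 hp0 hd0 hρlb' hplb'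
    hdlb' hlen n (by positivity) (by positivity) hb₀ hb₁ hb₂
  refine ⟨E, hE, ?_, fun ω hω ρfb Pfb => ?_⟩
  · have : 3 * δ ≤ C * δ := mul_le_mul_of_nonneg_right (by linarith) hδ.le
    linarith
  · obtain ⟨g₀, g₁, g₂, g₃⟩ := hEg ω hω
    obtain ⟨hus, hall⟩ := MOReL.guarantees_of_accurate M πb h0 h1 hC0 hr hρ0 hp0 hd0 hρlb' hplb'
      (Nat.cast_pos.1 hn0) ω g₀ g₁ g₂ g₃ ρfb Pfb
    refine ⟨hus, fun U hUs hU επ πout hout => ?_⟩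
    obtain ⟨hb, hstar⟩ := hall U hUs hU επ πout hout
    exact ⟨hb, fun πstar _ => hstar πstar⟩
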